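/- Let $d,n\ge 1$ and let $V=(v_i^{(j)})\in\mathbb{R}^{d\times n}$ be a matrix with real entries. Let $$L_V(x)=\sum_{j=1}^{n}\ \min_{1\le i\le d}\bigl(x_i-v_i^{(j)}\bigr),\qquad D(V)=\{(x,s)\in\mathbb{R}^d\times\mathbb{R} : s\le L_V(x)\}$$ be the tropical product of the $n$ min-tropical linear forms given by the columns of $V$, and its dome. The \emph{covector decomposition} of the tropical projective torus $\mathbb{R}^d/\mathbb{R}\mathbf{1}$ induced by $V$ is the collection of the images, under $(x,s)\mapsto x+\mathbb{R}\mathbf{1}$, of the nonempty proper faces of the polyhedron $D(V)$. Its \emph{compactification} in the one-point compactification $(\mathbb{R}^d/\mathbb{R}\mathbf{1})\cup\{*\}$ consists of the closures of these cells together with the point $\{*\}$. A total ordering $\sigma_1,\dots,\sigma_m$ of the maximal cells of a finite regular cell complex $\Sigma$ is a \emph{shelling} if either $\dim\Sigma\le 0$, or: (S1) $\partial\sigma_1$ has a shelling; (S2) for $2\le j\le m$ the complex $\partial\sigma_j\cap\bigcup_{k<j}\partial\sigma_k$ is pure of dimension $\dim\sigma_j-1$ (the empty complex having dimension $-1$);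 (S3) for $2\le j\le m$ the complex $\partial\sigma_j$ has a shelling in which the maximal cells of $\partial\sigma_j\cap\bigcup_{k<j}\partial\sigma_k$ appear first. The complex $\Sigma$ is \emph{shellable} if it has a shelling. Then $(\mathbb{R}^d/\mathbb{R}\mathbf{1})\cup\{*\}$ is homeomorphic to the sphere $\mathbb{S}^{d-1}$, the cells of the compactified covector decomposition are the closed cells of a finite regular cell complex structure on it, and this regular cell complex is shellable. -/

import Mathlib

noncomputable section

/-! ### Regular cell complexes and their shellings -/

namespace CellShelling

variable {X : Type*} [TopologicalSpace X] (C : Set X) [Topology.CWComplex C]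

/-- A finite CW complex is a (finite) regular cell complex if every closed cell, in particular its
boundary sphere, is embedded by its characteristic map. -/
def IsRegular : Prop :=
  ∀ (k : ℕ) (i : Topology.RelCWComplex.cell C k), Set.InjOn (Topology.RelCWComplex.map k i) (Metric.closedBall 0 1)

/-- The cells of `C` of all dimensions; the dimension of a cell `σ` is `σ.1`. -/
abbrev Cell := Σ k, Topology.RelCWComplex.cell C k

variable {C}

/-- The closed cell, as a subset of the ambient space. -/
def Cell.closed (σ : Cell C) : Set X := Topology.RelCWComplex.closedCell σ.1 σ.2

/-- The boundary complex `∂σ`: the cells contained in the boundary sphere of `σ`. -/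
def Cell.boundary (σ : Cell C) : Set (Cell C) :=
  {τ | τ.closed ⊆ Topology.RelCWComplex.cellFrontier σ.1 σ.2}

/-- The maximal cells, with respect to inclusion, of a set `S` of cells. -/
def maximalCells (S : Set (Cell C)) : Set (Cell C) :=
  {σ | σ ∈ S ∧ ∀ τ ∈ S, σ.closed ⊆ τ.closed → τ = σ}

/-- `S` is pure of dimension `k`: all its maximal cells have dimension `k`. The empty complex
has dimension `-1`, and it is pure of no other dimension. -/
def IsPureOfDim (S : Set (Cell C)) (k : ℤ) : Prop :=
  (∀ σ ∈ maximalCells S, (σ.1 : ℤ) = k) ∧ (S = ∅ → k = -1)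

/-- The list `l` is a total ordering of the maximal cells of `S`. -/
def IsOrderingOfMaximalCells (S : Set (Cell C)) (l : List (Cell C)) : Prop :=
  l.Nodup ∧ ∀ σ, σ ∈ l ↔ σ ∈ maximalCells S

/-- For a cell `σ` and a list `l₁` of cells, the complex `∂σ ∩ ⋃_{τ ∈ l₁} ∂τ`. -/
def attachingComplex (l₁ : List (Cell C)) (σ : Cell C) : Set (Cell C) :=
  σ.boundary ∩ ⋃ τ ∈ l₁, τ.boundary

/-- `IsShelling S l`: the ordering `l` of the maximal cells of the complex `S` is a (not necessarily
pure) shelling. In the inductive case `L σ` is the chosen shelling of `∂σ`, for `σ` in `l`. -/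
inductive IsShelling : Set (Cell C) → List (Cell C) → Prop
  | zero (S : Set (Cell C)) (l : List (Cell C)) (hl : IsOrderingOfMaximalCells S l)
      (h0 : ∀ σ ∈ S, σ.1 = 0) : IsShelling S l
  | step (S : Set (Cell C)) (l : List (Cell C)) (hl : IsOrderingOfMaximalCells S l)
      (L : Cell C → List (Cell C))
      (hL : ∀ σ ∈ l, IsShelling σ.boundary (L σ))
      (pure : ∀ l₁ σ l₂, l = l₁ ++ σ :: l₂ → l₁ ≠ [] →
        IsPureOfDim (attachingComplex l₁ σ) ((σ.1 : ℤ) - 1))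
      (initial : ∀ l₁ σ l₂, l = l₁ ++ σ :: l₂ → l₁ ≠ [] →
        ∃ k : ℕ, ∀ τ, τ ∈ (L σ).take k ↔ τ ∈ maximalCells (attachingComplex l₁ σ)) :
      IsShelling S l

variable (C) in
/-- The whole cell complex has a shelling. -/
def IsShellable : Prop := ∃ l : List (Cell C), IsShelling Set.univ l

end CellShelling

/-! ### Covector decompositions of the tropical projective torus -/

namespace TropicalCovector

/-- The tropical projective torus `ℝ^d / ℝ1`. -/
abbrev Torus (d : ℕ) : Type := (Fin d → ℝ) ⧸ Submodule.span ℝ {(1 : Fin d → ℝ)}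

/-- The tropical product `L_V` of the min-tropical linear forms
`L_j(x) = min_i (x_i - v_i^{(j)})` given by the columns of `V`. -/
def linearProduct {d n : ℕ} (V : Matrix (Fin d) (Fin n) ℝ) (x : Fin d → ℝ) : ℝ :=
  ∑ j, ⨅ i, (x i - V i j)

/-- The dome of `L_V`. -/
def dome {d n : ℕ} (V : Matrix (Fin d) (Fin n) ℝ) : Set ((Fin d → ℝ) × ℝ) :=
  {p | p.2 ≤ linearProduct V p.1}

/-- The covector decomposition induced by `V`, that is, the normal complex of `L_V`: its cells are
the images in `ℝ^d / ℝ1` of the (nonempty) proper faces of the dome of `L_V`. -/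
def decomposition {d n : ℕ} (V : Matrix (Fin d) (Fin n) ℝ) : Set (Set (Torus d)) :=
  {P | ∃ F : Set ((Fin d → ℝ) × ℝ), IsExposed ℝ (dome V) F ∧ F.Nonempty ∧ F ≠ dome V ∧
    P = (fun p => (Submodule.Quotient.mk p.1 : Torus d)) '' F}

/-- The closed cells of the compactified covector decomposition: the closures of the covector
cells in the one-point compactification, together with the point at infinity. -/
def compactifiedCells {d n : ℕ} (V : Matrix (Fin d) (Fin n) ℝ) :
    Set (Set (OnePoint (Torus d))) :=
  insert {OnePoint.infty}
    ((fun P : Set (Torus d) => closure ((↑) '' P : Set (OnePoint (Torus d)))) '' decomposition V)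

end TropicalCovector

end

/-! The graph of `L_V` is the boundary of its dome. After subtracting `n * x i₀` everything lives
over the torus `T`, so the covector cells are the proper faces of a polyhedron in `T × ℝ`. The added
point lies on exactly the cells with a recession direction. Homogenizing turns the polyhedron into a
cone `y ≥ 0` in `T × ℝ × ℝ`, pointed because `n ≥ 1`. A face is encoded by its support, the set of
functionals that are positive in its relative interior.

Combinatorics: a line shelling in the style of Bruggesser and Mani. `exists_height` provides a
functional `η`, in general position, that is positive on the bounded faces and takes negative values
exactly on faces with recession. The section `η = 0` stands for the point at infinity. For a face
`S`, take a generic interior point `q` and a point `p`, both of height zero if `S` is unbounded, and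
order the facets by the parameter `λ` at which `p - λ • q` meets their spans. The part of `∂F`
shared with earlier facets is generated by the facets of `F` visible from the point where the line
meets the span of `F` (`maximal_attachingFacet_iff`). This makes the strengthened claim inductive:
there is a shelling that begins with the facets visible from `p` (`exists_orderShelling_visible`).

Topology: a bounded cell is a ball by convexity. An unbounded one becomes a convex body under an
inversion sending infinity to the origin (`Data.exists_map`). These charts give a CW structure
indexed by the face poset (`Decomposition.cwComplex`), to which the shelling of the poset is
transferred (`isShelling_of_orderShelling`). Finally `decomposition_eq` identifies the cells with
those of the covector decomposition. -/

section

open Module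

/-! ### Faces of a pointed cone, truncation by a generic hyperplane, and visibility of facets. -/

namespace ConeShelling

variable {V J : Type*} [AddCommGroup V] [Module ℝ V]

/-- The common zeros of the functionals `y i` with `i` outside of `S`. -/
def flat (y : J → V →ₗ[ℝ] ℝ) (S : Set J) : Submodule ℝ V := ⨅ i ∈ Sᶜ, LinearMap.ker (y i)

/-- `S` is the support of a point of the cone `y ≥ 0` with positive height. -/
def IsFace (y : J → V →ₗ[ℝ] ℝ) (η : V →ₗ[ℝ] ℝ) (S : Set J) : Prop :=
  ∃ z, (∀ i ∈ S, 0 < y i z) ∧ (∀ i ∉ S, y i z = 0) ∧ 0 < η z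

/-- The face with support `S` contains points of negative height. -/
def IsUnb (y : J → V →ₗ[ℝ] ℝ) (η : V →ₗ[ℝ] ℝ) (S : Set J) : Prop :=
  ∃ z, (∀ i, 0 ≤ y i z) ∧ (∀ i ∉ S, y i z = 0) ∧ η z < 0

/-- The hyperplane `η = 0` is in general position with respect to the pointed cone `y ≥ 0`. -/
structure IsTruncated (y : J → V →ₗ[ℝ] ℝ) (η : V →ₗ[ℝ] ℝ) : Prop where
  pointed : ∀ z, (∀ i, y i z = 0) → z = 0
  face : ∀ z, (∀ i, 0 ≤ y i z) → z ≠ 0 → η z = 0 → IsFace y η {i | y i z ≠ 0}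
  unb : ∀ z, (∀ i, 0 ≤ y i z) → z ≠ 0 → η z = 0 → IsUnb y η {i | y i z ≠ 0}
  -- This ensures that a combination of `y i` and `y j` that is nonzero on `flat y S` stays nonzero
  -- on its height-zero part, so facets can be separated by lines of height zero.
  generic : ∀ S, IsFace y η S → 3 ≤ finrank ℝ (flat y S) → ∀ i j,
    ∃ v ∈ flat y S, y i v = 0 ∧ y j v = 0 ∧ η v ≠ 0

/-- `E` is a face of codimension one in `S`. -/
def IsFacet (y : J → V →ₗ[ℝ] ℝ) (η : V →ₗ[ℝ] ℝ) (E S : Set J) : Prop :=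
  IsFace y η E ∧ E ⊆ S ∧ finrank ℝ (flat y S) = finrank ℝ (flat y E) + 1

section Faces

variable {y : J → V →ₗ[ℝ] ℝ} {η : V →ₗ[ℝ] ℝ} {S A E F : Set J}

theorem mem_flat {z : V} : z ∈ flat y S ↔ ∀ i ∉ S, y i z = 0 := by
  simp [flat]

theorem flat_mono (h : A ⊆ S) : flat y A ≤ flat y S := fun _ hz =>
  mem_flat.2 fun i hi => mem_flat.1 hz i fun hA => hi (h hA)

theorem IsUnb.mono (hA : IsUnb y η A) (h : A ⊆ S) : IsUnb y η S := by
  obtain ⟨z, h0, hz, hη⟩ := hA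
  exact ⟨z, h0, fun i hi => hz i fun hA => hi (h hA), hη⟩

/-- The segment from a relatively interior point of positive height to a point of negative height
crosses height zero before its end, hence still in the relative interior. -/
theorem IsFace.exists_height_eq_zero (hS : IsFace y η S) (hu : IsUnb y η S) :
    ∃ q ∈ flat y S, (∀ i ∈ S, 0 < y i q) ∧ η q = 0 := by
  obtain ⟨z, hz, hz', hη⟩ := hS
  obtain ⟨w, hw, hw', hηw⟩ := hu
  refine ⟨(-η w) • z + η z • w, mem_flat.2 fun i hi => by simp [hz' i hi, hw' i hi], fun i hi => ?_,
    by simp; ring⟩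
  simp only [map_add, map_smul, smul_eq_mul]
  have := mul_pos (neg_pos.2 hηw) (hz i hi)
  have := mul_nonneg hη.le (hw i)
  linarith

theorem IsFacet.ssubset (h : IsFacet y η E S) : E ⊂ S := by
  refine h.2.1.ssubset_of_ne ?_
  rintro rfl
  have := h.2.2
  omega

end Faces

section Crossing

variable {y : J → V →ₗ[ℝ] ℝ} {η : V →ₗ[ℝ] ℝ} {S A E F : Set J} [Finite J]

theorem finrank_span_le_one (v : V) : finrank ℝ (ℝ ∙ v) ≤ 1 :=
  (finrank_span_le_card ({v} : Set V)).trans (by simp)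

/-- The first point where the segment from `q` to `p` leaves the region `y > 0`. -/
theorem exists_first_crossing (y : J → V →ₗ[ℝ] ℝ) (K : Set J) {q p : V}
    (hq : ∀ k ∈ K, 0 < y k q) (hp : ∃ k ∈ K, y k p < 0) :
    ∃ a b : ℝ, 0 < a ∧ 0 < b ∧ (∀ k ∈ K, 0 ≤ y k (a • q + b • p)) ∧
      (∃ k ∈ K, y k (a • q + b • p) = 0) ∧ ∀ k ∈ K, y k (a • q + b • p) = 0 → y k p < 0 := by
  -- The ratio is the value of `b / a` at which `y k` vanishes on `a • q + b • p`. The smallest one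
  -- is the exit.
  obtain ⟨k₀, ⟨hk₀, hk₀p⟩, hmin⟩ := Set.exists_min_image {k | k ∈ K ∧ y k p < 0}
    (fun k => y k q / - y k p) (Set.toFinite _) hp
  have hq₀ := hq k₀ hk₀
  refine ⟨- y k₀ p, y k₀ q, by linarith, hq₀, fun k hk => ?_, ⟨k₀, hk₀, by simp; ring⟩,
    fun k hk h0 => ?_⟩
  · simp only [map_add, map_smul, smul_eq_mul]
    rcases lt_or_ge (y k p) 0 with h | h
    · have := hmin k ⟨hk, h⟩
      rw [div_le_div_iff₀ (by linarith) (by linarith)] at this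
      linarith
    · have := mul_pos (neg_pos.2 hk₀p) (hq k hk)
      have := mul_nonneg hq₀.le h
      linarith
  · simp only [map_add, map_smul, smul_eq_mul] at h0
    have h1 := mul_pos (neg_pos.2 hk₀p) (hq k hk)
    by_contra! h
    have := mul_nonneg hq₀.le h
    linarith

theorem exists_pos_smul_add {K : Set J} (Λ : Set (V →ₗ[ℝ] ℝ)) (hΛ : Λ.Finite)
    (y : J → V →ₗ[ℝ] ℝ) {z x : V} (hz : ∀ i ∈ K, 0 < y i z) (hl : ∀ l ∈ Λ, 0 < l z) :
    ∃ t : ℝ, 0 < t ∧ (∀ i ∈ K, 0 < y i (z + t • x)) ∧ ∀ l ∈ Λ, 0 < l (z + t • x) := by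
  have key : ∀ l : V →ₗ[ℝ] ℝ, 0 < l z → ∀ᶠ t : ℝ in nhdsWithin 0 (Set.Ioi 0), 0 < l (z + t • x) := by
    intro l h
    have hc : ContinuousAt (fun t : ℝ => l z + t * l x) 0 := by fun_prop
    have := hc.eventually (lt_mem_nhds (a := 0) (by simpa using h))
    filter_upwards [nhdsWithin_le_nhds this] with t ht
    simpa using ht
  have h1 := (Filter.eventually_all_finite (Set.toFinite K)).2 fun i hi => key (y i) (hz i hi)
  have h2 := (Filter.eventually_all_finite hΛ).2 fun l h => key l (hl l h)
  have h3 : ∀ᶠ t : ℝ in nhdsWithin 0 (Set.Ioi 0), 0 < t := self_mem_nhdsWithin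
  obtain ⟨t, h⟩ := (h1.and (h2.and h3)).exists
  exact ⟨t, h.2.2, h.1, h.2.1⟩

/-- Moving slightly from a face towards a point of its local cone. -/
theorem IsFace.exists_support_add (hA : IsFace y η A) {x : V} (h0 : ∀ i ∉ A, 0 ≤ y i x) :
    IsFace y η (A ∪ {i | y i x ≠ 0}) := by
  obtain ⟨z, hz, hz', hη⟩ := hA
  obtain ⟨t, ht, h1, h2⟩ := exists_pos_smul_add (x := x) {η} (Set.toFinite _) y hz (by simpa using hη)
  refine ⟨z + t • x, fun i hi => ?_, fun i hi => ?_, h2 η rfl⟩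
  · by_cases hiA : i ∈ A
    · exact h1 i hiA
    · have : y i x ≠ 0 := by simpa [hiA] using hi
      simpa [hz' i hiA] using mul_pos ht (lt_of_le_of_ne (h0 i hiA) this.symm)
  · simp only [Set.mem_union, Set.mem_ofPred_eq, not_or, not_not] at hi
    simp [hz' i hi.1, hi.2]

/-- A vector of a subspace `U` at which the functionals `y i`, `i ∈ K`, are positive can be moved
off finitely many hyperplanes. -/
theorem exists_generic (y : J → V →ₗ[ℝ] ℝ) (U : Submodule ℝ V) {K : Set J} (Λ : Set (V →ₗ[ℝ] ℝ))
    (hΛ : Λ.Finite) (hU : ∃ q ∈ U, ∀ i ∈ K, 0 < y i q) (hl : ∀ l ∈ Λ, ∃ v ∈ U, l v ≠ 0) :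
    ∃ q ∈ U, (∀ i ∈ K, 0 < y i q) ∧ ∀ l ∈ Λ, l q ≠ 0 := by
  classical
  induction Λ, hΛ using Set.Finite.induction_on with
  | empty => simpa using hU
  | @insert l Λ hlΛ hΛ ih =>
    obtain ⟨q, hqU, hq, hqΛ⟩ := ih fun l' h => hl l' (Set.mem_insert_of_mem _ h)
    by_cases h0 : l q = 0
    swap
    · exact ⟨q, hqU, hq, by rintro l' (rfl | h); exacts [h0, hqΛ l' h]⟩
    obtain ⟨v, hvU, hv⟩ := hl l (Set.mem_insert _ _)
    -- The form `(l' q) • l'` equals `(l' q) ^ 2 > 0` at `q`, so staying off the earlier hyperplanes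
    -- becomes a strict inequality.
    obtain ⟨t, ht, h1, h2⟩ := exists_pos_smul_add (x := v)
      ((fun l' : V →ₗ[ℝ] ℝ => (l' q) • l') '' Λ) (hΛ.image _) y hq (by
        rintro _ ⟨l', h, rfl⟩
        simpa using hqΛ l' h)
    refine ⟨q + t • v, add_mem hqU (Submodule.smul_mem _ _ hvU), h1, ?_⟩
    rintro l' (rfl | h)
    · simp [h0, hv, ht.ne']
    · have := h2 _ ⟨l', h, rfl⟩
      intro h'
      simp only [LinearMap.smul_apply, h', smul_zero, lt_irrefl] at this

/-- A point at the relative interior which is not a multiple of a given vector. -/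
theorem exists_notMem_span (y : J → V →ₗ[ℝ] ℝ) {U : Submodule ℝ V} (hU : 2 ≤ finrank ℝ U) {q p : V}
    (hqU : q ∈ U) (hq : ∀ i ∈ S, 0 < y i q) (hp0 : p ≠ 0) :
    ∃ q' ∈ U, (∀ i ∈ S, 0 < y i q') ∧ ∀ a b : ℝ, b ≠ 0 → a • q' + b • p ≠ 0 := by
  have hnot : ∃ v ∈ U, v ∉ ℝ ∙ p := by
    by_contra! h
    have := Submodule.finrank_mono (show U ≤ ℝ ∙ p from h)
    have := finrank_span_le_one p
    omega
  obtain ⟨v, hvU, hv⟩ := hnot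
  have key : ∀ q' : V, q' ∉ ℝ ∙ p → ∀ a b : ℝ, b ≠ 0 → a • q' + b • p ≠ 0 := by
    intro q' hq' a b hb h0
    rcases eq_or_ne a 0 with rfl | ha
    · simp [hb, hp0] at h0
    · refine hq' (Submodule.mem_span_singleton.2 ⟨-(a⁻¹ * b), ?_⟩)
      have : q' = a⁻¹ • (a • q' + b • p) - (a⁻¹ * b) • p := by
        simp [smul_smul, ha]
      rw [this, h0]; simp
  by_cases hqp : q ∈ ℝ ∙ p
  · obtain ⟨t, ht, h1, -⟩ := exists_pos_smul_add (x := v) ∅ (Set.toFinite _) y hq (by simp)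
    refine ⟨q + t • v, add_mem hqU (Submodule.smul_mem _ _ hvU), h1, key _ fun h => hv ?_⟩
    have := Submodule.smul_mem _ t⁻¹ (sub_mem h hqp)
    simpa [smul_smul, ht.ne'] using this
  · exact ⟨q, hqU, hq, key q hqp⟩

end Crossing

section Dimension

variable {y : J → V →ₗ[ℝ] ℝ} {η : V →ₗ[ℝ] ℝ} {S A E F : Set J} [FiniteDimensional ℝ V]

theorem IsFace.finrank_lt (hS : IsFace y η S) (h : A ⊂ S) :
    finrank ℝ (flat y A) < finrank ℝ (flat y S) := by
  obtain ⟨z, hz, hz', -⟩ := hS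
  obtain ⟨i, hi, hiA⟩ := Set.exists_of_ssubset h
  apply Submodule.finrank_lt_finrank_of_lt
  refine lt_of_le_of_ne (flat_mono h.subset) fun he => ?_
  have : z ∈ flat y A := he ▸ mem_flat.2 hz'
  exact (hz i hi).ne' (mem_flat.1 this i hiA)

theorem IsFace.eq_of_subset (hS : IsFace y η S) (h : A ⊆ S)
    (hd : finrank ℝ (flat y S) ≤ finrank ℝ (flat y A)) : A = S := by
  by_contra hne
  exact absurd (hS.finrank_lt (h.ssubset_of_ne hne)) (not_lt.2 hd)

theorem IsFace.finrank_pos (hS : IsFace y η S) : 0 < finrank ℝ (flat y S) := by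
  obtain ⟨z, hz, hz', hη⟩ := hS
  rw [Module.finrank_pos_iff_exists_ne_zero]
  refine ⟨⟨z, mem_flat.2 hz'⟩, fun h => ?_⟩
  have : z = 0 := congrArg Subtype.val h
  simp [this] at hη

theorem IsFacet.not_subset (hE : IsFacet y η E S) (hF : IsFacet y η F S) (hne : E ≠ F) :
    ∃ i ∈ E, i ∉ F := by
  by_contra! h
  exact hne (hF.1.eq_of_subset h (by have := hE.2.2; have := hF.2.2; omega))

/-- On the span of a face, functionals vanishing on the same facet are proportional. -/
theorem IsFacet.mul_eq_mul (h : IsFacet y η E S) {z q : V} (hz : z ∈ flat y S) (hq : q ∈ flat y S)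
    {i k : J} (hi : i ∉ E) (hk : k ∉ E) (hS : IsFace y η S) :
    y i z * y k q = y k z * y i q := by
  by_cases hkS : k ∈ S
  swap
  · rw [mem_flat.1 hz k hkS, mem_flat.1 hq k hkS]; ring
  obtain ⟨s, hs, hs', -⟩ := hS
  have hle : flat y E ≤ flat y S ⊓ LinearMap.ker (y k) :=
    le_inf (flat_mono h.2.1) fun v hv => mem_flat.1 hv k hk
  have hlt : flat y S ⊓ LinearMap.ker (y k) < flat y S := by
    refine lt_of_le_of_ne inf_le_left fun he => ?_
    have : s ∈ flat y S ⊓ LinearMap.ker (y k) := he.symm ▸ (mem_flat.2 hs' : s ∈ flat y S)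
    exact (hs k hkS).ne' this.2
  have heq : flat y E = flat y S ⊓ LinearMap.ker (y k) := by
    apply Submodule.eq_of_le_of_finrank_le hle
    have := Submodule.finrank_lt_finrank_of_lt hlt
    have := h.2.2
    omega
  -- Within `flat y S` the span of the facet is the kernel of `y k`, and this combination is killed
  -- by `y k`, hence also by `y i`.
  have hw : y k q • z - y k z • q ∈ flat y E := by
    rw [heq]
    refine ⟨sub_mem (Submodule.smul_mem _ _ hz) (Submodule.smul_mem _ _ hq), ?_⟩
    simp; ring
  have := mem_flat.1 hw i hi
  simp at this
  linarith

end Dimension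

section Facets

variable {y : J → V →ₗ[ℝ] ℝ} {η : V →ₗ[ℝ] ℝ} {S A E F : Set J} [Finite J]

variable [FiniteDimensional ℝ V]

/-- Codimension at least two leaves a direction `v` in `flat y S` outside `flat y A ⊔ ℝ ∙ q`. Moving
from the interior point `q` towards `v` until the local cone at `A` is left gives a point whose
support, joined to `A`, is strictly between: larger than `A` by the choice of `v`, smaller than `S`
because some functional vanishes there. -/
theorem IsFace.exists_between (hA : IsFace y η A) (hS : IsFace y η S)
    (hAS : A ⊆ S) (hd : finrank ℝ (flat y A) + 2 ≤ finrank ℝ (flat y S)) :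
    ∃ E, IsFace y η E ∧ A ⊂ E ∧ E ⊂ S := by
  obtain ⟨q, hq, hq', -⟩ := hS
  have hqS : q ∈ flat y S := mem_flat.2 hq'
  have hlt : flat y A ⊔ ℝ ∙ q < flat y S := by
    have hle : flat y A ⊔ ℝ ∙ q ≤ flat y S :=
      sup_le (flat_mono hAS) ((Submodule.span_singleton_le_iff_mem _ _).2 hqS)
    refine lt_of_le_of_ne hle fun he => ?_
    have h1 := Submodule.finrank_add_le_finrank_add_finrank (flat y A) (ℝ ∙ q)
    have h2 := finrank_span_le_one q
    rw [he] at h1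
    omega
  obtain ⟨v, hvS, hv⟩ := SetLike.exists_of_lt hlt
  have hv0 : ∃ i ∈ S \ A, y i v ≠ 0 := by
    by_contra! h
    refine hv (Submodule.mem_sup_left (mem_flat.2 fun i hi => ?_))
    by_cases hiS : i ∈ S
    · exact h i ⟨hiS, hi⟩
    · exact mem_flat.1 hvS i hiS
  obtain ⟨v, hvS, hv, i, hi, hvi⟩ : ∃ v ∈ flat y S, v ∉ flat y A ⊔ ℝ ∙ q ∧ ∃ i ∈ S \ A, y i v < 0 := by
    obtain ⟨i, hi, hvi⟩ := hv0
    rcases lt_or_gt_of_ne hvi with h | h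
    · exact ⟨v, hvS, hv, i, hi, h⟩
    · exact ⟨-v, neg_mem hvS, fun h => hv (by simpa using neg_mem h), i, hi, by simpa using h⟩
  obtain ⟨a, b, ha, hb, h0, ⟨k, hk, hk0⟩, -⟩ := exists_first_crossing y (S \ A) (p := v)
    (fun k hk => hq k hk.1) ⟨i, hi, hvi⟩
  set x := a • q + b • v
  have hxS : x ∈ flat y S := add_mem (Submodule.smul_mem _ _ hqS) (Submodule.smul_mem _ _ hvS)
  refine ⟨_, hA.exists_support_add (x := x) fun i hi => ?_, ?_, ?_⟩
  · by_cases hiS : i ∈ S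
    · exact h0 i ⟨hiS, hi⟩
    · exact (mem_flat.1 hxS i hiS).ge
  · refine Set.ssubset_iff_exists.2 ⟨Set.subset_union_left, ?_⟩
    by_contra! h
    refine hv ?_
    have hxA : x ∈ flat y A := mem_flat.2 fun i hi => by
      by_contra hne
      exact hi (h i (Or.inr hne))
    have : v = b⁻¹ • x + (-(b⁻¹ * a)) • q := by
      simp only [x, smul_add, smul_smul, inv_mul_cancel₀ hb.ne', one_smul, neg_smul]; abel
    rw [this]
    exact add_mem (Submodule.mem_sup_left (Submodule.smul_mem _ _ hxA))
      (Submodule.mem_sup_right (Submodule.smul_mem _ _ (Submodule.mem_span_singleton_self q)))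
  · refine Set.ssubset_iff_exists.2 ⟨Set.union_subset hAS fun i hi => ?_, k, hk.1, ?_⟩
    · by_contra hiS
      exact hi (mem_flat.1 hxS i hiS)
    · simpa [hk0] using hk.2

theorem IsFace.exists_facet (hA : IsFace y η A) (hS : IsFace y η S)
    (hAS : A ⊂ S) : ∃ E, IsFacet y η E S ∧ A ⊆ E := by
  obtain ⟨E, hAE, hE⟩ := (Set.toFinite {E | IsFace y η E ∧ E ⊂ S}).exists_le_maximal ⟨hA, hAS⟩
  refine ⟨E, ⟨hE.prop.1, hE.prop.2.subset, ?_⟩, hAE⟩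
  have h1 := hS.finrank_lt hE.prop.2
  by_contra hne
  obtain ⟨E', hE', h2, h3⟩ := hE.prop.1.exists_between hS hE.prop.2.subset (by omega)
  exact h2.not_subset (hE.le_of_ge ⟨hE', h3⟩ h2.subset)

/-- A point of the span of a face which violates an inequality of its local cone at `A` violates
the inequality of a facet containing `A`. -/
theorem IsFace.exists_visible (hA : IsFace y η A) (hS : IsFace y η S)
    (hAS : A ⊆ S) {p : V} (hp : p ∈ flat y S) (h : ∃ i ∈ S \ A, y i p < 0) :
    ∃ E, IsFacet y η E S ∧ A ⊆ E ∧ ∀ k ∈ S \ E, y k p < 0 := by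
  obtain ⟨q, hq, hq', -⟩ := id hS
  obtain ⟨a, b, ha, hb, h0, ⟨k, hk, hk0⟩, h1⟩ := exists_first_crossing y (S \ A) (p := p)
    (fun k hk => hq k hk.1) h
  set x := a • q + b • p
  have hxS : x ∈ flat y S :=
    add_mem (Submodule.smul_mem _ _ (mem_flat.2 hq')) (Submodule.smul_mem _ _ hp)
  obtain ⟨E, hE, hE'⟩ := (hA.exists_support_add (x := x) fun i hi => by
    by_cases hiS : i ∈ S
    · exact h0 i ⟨hiS, hi⟩
    · exact (mem_flat.1 hxS i hiS).ge).exists_facet hS (by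
      refine Set.ssubset_iff_exists.2 ⟨Set.union_subset hAS fun i hi => ?_, k, hk.1, ?_⟩
      · by_contra hiS
        exact hi (mem_flat.1 hxS i hiS)
      · simpa [hk0] using hk.2)
  refine ⟨E, hE, Set.subset_union_left.trans hE', fun k hk => ?_⟩
  refine h1 k ⟨hk.1, fun hkA => hk.2 (hE' (Or.inl hkA))⟩ ?_
  by_contra hne
  exact hk.2 (hE' (Or.inr hne))

/-- Any facet through the point where the segment from `q` to `p` leaves the cone is visible from
`p`. The hypothesis `hface` isolates what has to be known about that exit point, namely that its
support is a face. The reason differs between bounded and unbounded `S`. -/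
theorem IsFace.exists_visible_of_mem (hS : IsFace y η S) {p q : V}
    (hq : ∀ i ∈ S, 0 < y i q) (hqS : q ∈ flat y S) (hp : p ∈ flat y S) (h : ∃ i ∈ S, y i p < 0)
    (hface : ∀ a b : ℝ, 0 < b → (∀ i, 0 ≤ y i (a • q + b • p)) →
      IsFace y η {i | y i (a • q + b • p) ≠ 0}) :
    ∃ a b : ℝ, 0 < b ∧ (∀ i, 0 ≤ y i (a • q + b • p)) ∧ ∃ E, IsFacet y η E S ∧
      {i | y i (a • q + b • p) ≠ 0} ⊆ E ∧ ∀ k ∈ S \ E, y k p < 0 := by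
  obtain ⟨a, b, ha, hb, h0, ⟨k, hk, hk0⟩, h1⟩ := exists_first_crossing y S hq h
  have hxS : a • q + b • p ∈ flat y S :=
    add_mem (Submodule.smul_mem _ _ hqS) (Submodule.smul_mem _ _ hp)
  have h0' : ∀ i, 0 ≤ y i (a • q + b • p) := fun i => by
    by_cases hiS : i ∈ S
    · exact h0 i hiS
    · exact (mem_flat.1 hxS i hiS).ge
  obtain ⟨E, hE, hE'⟩ := (hface a b hb h0').exists_facet hS
    (Set.ssubset_iff_exists.2 ⟨fun i hi => by
      by_contra hiS
      exact hi (mem_flat.1 hxS i hiS), k, hk, by simpa using hk0⟩)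
  refine ⟨a, b, hb, h0', E, hE, hE', fun k hk => h1 k hk.1 ?_⟩
  by_contra hne
  exact hk.2 (hE' hne)

theorem finrank_le_inf_ker (U : Submodule ℝ V) (l : V →ₗ[ℝ] ℝ) :
    finrank ℝ U ≤ finrank ℝ (U ⊓ LinearMap.ker l : Submodule ℝ V) + 1 := by
  have h := Submodule.finrank_sup_add_finrank_inf_eq U (LinearMap.ker l)
  have h1 := Submodule.finrank_le (U ⊔ LinearMap.ker l)
  have h2 := LinearMap.finrank_range_add_finrank_ker l
  have h3 := Submodule.finrank_le (LinearMap.range l)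
  rw [finrank_self] at h3
  omega

/-- A point at height zero outside of an unbounded face sees an unbounded facet. -/
theorem IsFace.exists_visible_unb (hy : IsTruncated y η) (hS : IsFace y η S) (hu : IsUnb y η S)
    (hd : 3 ≤ finrank ℝ (flat y S)) {p : V} (hp : p ∈ flat y S) (hηp : η p = 0)
    (h : ∃ i ∈ S, y i p < 0) :
    ∃ E, IsFacet y η E S ∧ IsUnb y η E ∧ ∀ k ∈ S \ E, y k p < 0 := by
  have hp0 : p ≠ 0 := by rintro rfl; simp at h
  obtain ⟨q, hqS, hq, hηq⟩ := hS.exists_height_eq_zero hu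
  -- Both ends of the segment have height zero and are not proportional, so the exit point is a
  -- nonzero cone point of height zero. The fields `face` and `unb` apply to it, and any facet
  -- through it is unbounded. The hypothesis `hd` leaves at least two dimensions at height zero.
  obtain ⟨q, ⟨hqS, hηq⟩, hq, hne⟩ := exists_notMem_span (S := S) (p := p) y
    (U := flat y S ⊓ LinearMap.ker η) (by have := finrank_le_inf_ker (flat y S) η; omega)
    ⟨hqS, hηq⟩ hq hp0
  have hη0 : ∀ a b : ℝ, η (a • q + b • p) = 0 := fun a b => by
    simp [LinearMap.mem_ker.1 hηq, hηp]
  obtain ⟨a, b, hb, h0, E, hE, hE', hv⟩ := hS.exists_visible_of_mem hq hqS hp h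
    fun a b hb h0 => hy.face _ h0 (hne a b hb.ne') (hη0 a b)
  exact ⟨E, hE, (hy.unb _ h0 (hne a b hb.ne') (hη0 a b)).mono hE', hv⟩

/-- In a bounded face every nonzero cone point has positive height: negative height would make `S`
unbounded by definition, height zero by the field `unb`. -/
theorem IsFace.exists_visible_of_not_unb (hy : IsTruncated y η) (hS : IsFace y η S)
    (hu : ¬ IsUnb y η S) (hd : 2 ≤ finrank ℝ (flat y S)) {p : V} (hp : p ∈ flat y S)
    (h : ∃ i ∈ S, y i p < 0) :
    ∃ E, IsFacet y η E S ∧ ∀ k ∈ S \ E, y k p < 0 := by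
  have hp0 : p ≠ 0 := by rintro rfl; simp at h
  obtain ⟨q, hq, hq', -⟩ := id hS
  obtain ⟨q, hqS, hq, hne⟩ := exists_notMem_span (S := S) (p := p) y hd (mem_flat.2 hq') hq hp0
  obtain ⟨a, b, hb, h0, E, hE, hE', hv⟩ := hS.exists_visible_of_mem hq hqS hp h
    fun a b hb h0 => by
      have hx : ∀ i ∉ S, y i (a • q + b • p) = 0 := mem_flat.1
        (add_mem (Submodule.smul_mem _ _ hqS) (Submodule.smul_mem _ _ hp))
      have hsub : {i | y i (a • q + b • p) ≠ 0} ⊆ S := fun i hi => by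
        by_contra hiS
        exact hi (hx i hiS)
      refine ⟨a • q + b • p, fun i hi => lt_of_le_of_ne (h0 i) (Ne.symm hi), fun i hi => by
        simpa using hi, ?_⟩
      rcases lt_trichotomy (η (a • q + b • p)) 0 with h | h | h
      · exact absurd ⟨_, h0, hx, h⟩ hu
      · exact absurd ((hy.unb _ h0 (hne a b hb.ne') h).mono hsub) hu
      · exact h
  exact ⟨E, hE, hv⟩

/-- Faces of positive dimension have facets. -/
theorem IsFace.exists_isFacet (hy : IsTruncated y η) (hS : IsFace y η S)
    (hd : 2 ≤ finrank ℝ (flat y S)) : ∃ E, IsFacet y η E S := by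
  obtain ⟨q, hq, hq', hηq⟩ := id hS
  have hqS := mem_flat.2 hq'
  have hpos : 0 < finrank ℝ (flat y S ⊓ LinearMap.ker η : Submodule ℝ V) := by
    have := finrank_le_inf_ker (flat y S) η; omega
  -- Leaving the cone from `q` along a direction of height zero keeps the height positive, so the
  -- exit point spans a face.
  obtain ⟨⟨v, hvS, hηv⟩, hv⟩ := Module.finrank_pos_iff_exists_ne_zero.1 hpos
  have hv : v ≠ 0 := fun h => hv (Subtype.ext h)
  replace hηv : η v = 0 := hηv
  obtain ⟨v, hvS, hηv, i, hi⟩ : ∃ v ∈ flat y S, η v = 0 ∧ ∃ i, y i v < 0 := by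
    have : ∃ i, y i v ≠ 0 := by
      by_contra! h
      exact hv (hy.pointed v h)
    obtain ⟨i, hi⟩ := this
    rcases lt_or_gt_of_ne hi with h | h
    · exact ⟨v, hvS, hηv, i, h⟩
    · exact ⟨-v, neg_mem hvS, by simpa using hηv, i, by simpa using h⟩
  have hiS : i ∈ S := by
    by_contra h
    exact hi.ne (mem_flat.1 hvS i h)
  obtain ⟨a, b, ha, hb, h0, ⟨k, hk, hk0⟩, -⟩ := exists_first_crossing y S hq ⟨i, hiS, hi⟩
  have hxS : a • q + b • v ∈ flat y S :=
    add_mem (Submodule.smul_mem _ _ hqS) (Submodule.smul_mem _ _ hvS)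
  have hF : IsFace y η {i | y i (a • q + b • v) ≠ 0} := by
    refine ⟨_, fun i hi => lt_of_le_of_ne ?_ (Ne.symm hi), fun i hi => by simpa using hi,
      by simpa [hηv] using mul_pos ha hηq⟩
    by_cases hiS : i ∈ S
    · exact h0 i hiS
    · exact (mem_flat.1 hxS i hiS).ge
  obtain ⟨E, hE, -⟩ := hF.exists_facet hS (Set.ssubset_iff_exists.2 ⟨fun i hi => by
      by_contra hiS
      exact hi (mem_flat.1 hxS i hiS), k, hk, by simpa using hk0⟩)
  exact ⟨E, hE⟩

/-- Every point outside of a face of positive dimension sees a facet. -/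
theorem IsFace.exists_visible_facet (hy : IsTruncated y η) (hS : IsFace y η S)
    (hd : 2 ≤ finrank ℝ (flat y S)) {p : V} (hp : p ∈ flat y S) (hηp : IsUnb y η S → η p = 0)
    (h : ∃ i ∈ S, y i p < 0) :
    ∃ E, IsFacet y η E S ∧ ∀ k ∈ S \ E, y k p < 0 := by
  by_cases hu : IsUnb y η S
  swap
  · exact hS.exists_visible_of_not_unb hy hu hd hp h
  rcases hd.eq_or_lt with hd | hd
  swap
  · obtain ⟨E, hE, -, hv⟩ := hS.exists_visible_unb hy hu hd hp (hηp hu) h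
    exact ⟨E, hE, hv⟩
  obtain ⟨E, hE⟩ := hS.exists_isFacet hy hd.le
  refine ⟨E, hE, fun k hk => ?_⟩
  obtain ⟨q, hqS, hq, hηq⟩ := hS.exists_height_eq_zero hu
  obtain ⟨z, hz, hz', hηz⟩ := id hS
  have hzS := mem_flat.2 hz'
  obtain ⟨i, hi, hip⟩ := h
  -- the points of height zero form a line, spanned by `q`
  have hlt : flat y S ⊓ LinearMap.ker η < flat y S :=
    lt_of_le_of_ne inf_le_left fun he => hηz.ne' (he.symm ▸ hzS : z ∈ _ ⊓ LinearMap.ker η).2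
  have hle : ℝ ∙ q ≤ flat y S ⊓ LinearMap.ker η :=
    (Submodule.span_singleton_le_iff_mem _ _).2 ⟨hqS, hηq⟩
  have hq0 : q ≠ 0 := by rintro rfl; simpa using hq i hi
  have heq := Submodule.eq_of_le_of_finrank_le hle (by
    rw [finrank_span_singleton hq0]
    have := Submodule.finrank_lt_finrank_of_lt hlt
    omega)
  have hpq : p ∈ ℝ ∙ q := heq ▸ ⟨hp, hηp hu⟩
  obtain ⟨c, rfl⟩ := Submodule.mem_span_singleton.1 hpq
  have hc : c < 0 := by
    have := hq i hi
    simp only [map_smul, smul_eq_mul] at hip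
    by_contra! h
    exact absurd hip (not_lt.2 (mul_nonneg h this.le))
  simpa using mul_neg_of_neg_of_pos hc (hq k hk.1)

/-- A face of codimension two lies in a second facet. -/
theorem IsFacet.exists_ne (hE : IsFacet y η E F) (hF : IsFacet y η F S)
    (hS : IsFace y η S) : ∃ G, IsFacet y η G S ∧ G ≠ F ∧ E ⊆ G := by
  obtain ⟨q, hq, hq', -⟩ := id hS
  obtain ⟨f, hf, hf', -⟩ := id hF.1
  obtain ⟨i, hiF, hiE⟩ := Set.exists_of_ssubset hE.ssubset
  obtain ⟨j, hjS, hjF⟩ := Set.exists_of_ssubset hF.ssubset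
  have hqf := hf i hiF
  -- `q - M • f` is negative at `i` and agrees with `q` at every `j ∉ F`. It therefore sees a facet
  -- through `E`, and this facet is not `F`.
  set M := y i q / y i f + 1
  obtain ⟨G, hG, hEG, h⟩ := hE.1.exists_visible hS (hE.2.1.trans hF.2.1) (p := q - M • f)
    (sub_mem (mem_flat.2 hq') (Submodule.smul_mem _ _ (flat_mono hF.2.1 (mem_flat.2 hf'))))
    ⟨i, ⟨hF.2.1 hiF, hiE⟩, by simp [M, add_mul, div_mul_cancel₀ _ hqf.ne', hqf]⟩
  refine ⟨G, hG, ?_, hEG⟩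
  rintro rfl
  have := h j ⟨hjS, hjF⟩
  simp only [map_sub, map_smul, hf' j hjF, smul_zero, sub_zero] at this
  exact absurd this (not_lt.2 (hq j hjS).le)

end Facets
end ConeShelling

end

/-! ### Line shellings of the face poset with a point at infinity. -/

section

open Module

namespace ConeShelling

/-- For an element `σ` and a list `l₁` of elements of the face poset, the complex
`∂σ ∩ ⋃_{τ ∈ l₁} ∂τ`. -/
def attaching {α : Type*} [PartialOrder α] (l₁ : List α) (σ : α) : Set α :=
  Set.Iio σ ∩ ⋃ τ ∈ l₁, Set.Iio τ

/-- Shellings of sets of cells, in terms of the face poset. -/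
inductive OrderShelling {α : Type*} [PartialOrder α] (dim : α → ℕ) : Set α → List α → Prop
  | zero (S : Set α) (l : List α) (hd : l.Nodup) (hl : ∀ σ, σ ∈ l ↔ Maximal (· ∈ S) σ)
      (h0 : ∀ σ ∈ S, dim σ = 0) : OrderShelling dim S l
  | step (S : Set α) (l : List α) (hd : l.Nodup) (hl : ∀ σ, σ ∈ l ↔ Maximal (· ∈ S) σ)
      (L : α → List α) (hL : ∀ σ ∈ l, OrderShelling dim (Set.Iio σ) (L σ))
      (pure : ∀ l₁ σ l₂, l = l₁ ++ σ :: l₂ → l₁ ≠ [] →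
        (attaching l₁ σ).Nonempty ∧ ∀ τ, Maximal (· ∈ attaching l₁ σ) τ → dim τ + 1 = dim σ)
      (initial : ∀ l₁ σ l₂, l = l₁ ++ σ :: l₂ → l₁ ≠ [] →
        ∃ k : ℕ, ∀ τ, τ ∈ (L σ).take k ↔ Maximal (· ∈ attaching l₁ σ) τ) :
      OrderShelling dim S l

theorem exists_list_pairwise_lt {α : Type*} {s : Set α} (hs : s.Finite) (f : α → ℝ)
    (hf : Set.InjOn f s) :
    ∃ l : List α, l.Nodup ∧ (∀ a, a ∈ l ↔ a ∈ s) ∧ l.Pairwise fun a b => f a < f b := by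
  classical
  induction hn : hs.toFinset.card generalizing s with
  | zero =>
    have : s = ∅ := by simpa using hn
    exact ⟨[], by simp [this]⟩
  | succ n ih =>
    have hne : s.Nonempty := by
      rw [← hs.toFinset_nonempty, ← Finset.card_pos]; omega
    obtain ⟨a, ha, hmin⟩ := Set.exists_min_image s f hs hne
    obtain ⟨l, hd, hl, hp⟩ := ih (s := s \ {a}) (hs.subset Set.sdiff_subset)
      (hf.mono Set.sdiff_subset) (by
        have : (hs.subset (Set.sdiff_subset (t := {a}))).toFinset = hs.toFinset.erase a := by
          ext; simp [and_comm]
        rw [this, Finset.card_erase_of_mem (by simpa using ha)]; omega)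
    refine ⟨a :: l, List.nodup_cons.2 ⟨by simp [hl], hd⟩, fun b => ?_, List.pairwise_cons.2
      ⟨fun b hb => ?_, hp⟩⟩
    · rw [List.mem_cons, hl]
      by_cases hb : b = a
      · simp [hb, ha]
      · simp [hb]
    · obtain ⟨hbs, hba⟩ := (hl b).1 hb
      exact lt_of_le_of_ne (hmin b hbs) fun h => hba (hf hbs ha h.symm)

theorem exists_take_iff_lt {α : Type*} {l : List α} {f : α → ℝ}
    (hl : l.Pairwise fun a b => f a < f b) (c : ℝ) :
    ∃ m, ∀ a, a ∈ l.take m ↔ a ∈ l ∧ f a < c := by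
  induction l with
  | nil => exact ⟨0, by simp⟩
  | cons b l ih =>
    rw [List.pairwise_cons] at hl
    obtain ⟨m, hm⟩ := ih hl.2
    by_cases hb : f b < c
    · refine ⟨m + 1, fun a => ?_⟩
      simp only [List.take_succ_cons, List.mem_cons, hm]
      constructor
      · rintro (rfl | h)
        exacts [⟨Or.inl rfl, hb⟩, ⟨Or.inr h.1, h.2⟩]
      · rintro ⟨rfl | h, h'⟩
        exacts [Or.inl rfl, Or.inr ⟨h, h'⟩]
    · refine ⟨0, fun a => ?_⟩
      simp only [List.take_zero, List.not_mem_nil, List.mem_cons, false_iff, not_and]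
      rintro (rfl | h)
      · exact hb
      · have := hl.1 a h
        intro h'
        exact hb (this.trans h')

theorem mem_left_iff_of_pairwise_lt {α : Type*} {l l₁ l₂ : List α} {f : α → ℝ} {σ : α}
    (hl : l.Pairwise fun a b => f a < f b) (h : l = l₁ ++ σ :: l₂) (τ : α) :
    τ ∈ l₁ ↔ τ ∈ l ∧ f τ < f σ := by
  subst h
  simp only [List.pairwise_append, List.pairwise_cons] at hl
  constructor
  · intro hτ
    exact ⟨by simp [hτ], hl.2.2 τ hτ σ (by simp)⟩
  · rintro ⟨hτ, hlt⟩
    simp only [List.mem_append, List.mem_cons] at hτ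
    rcases hτ with h | rfl | h
    · exact h
    · exact absurd hlt (lt_irrefl _)
    · exact absurd hlt (hl.2.1.1 τ h).not_gt

variable {V J : Type*} [AddCommGroup V] [Module ℝ V]

/-- The cells of the one-point compactification of a polyhedron: the point at infinity and the
faces. -/
inductive CCell (y : J → V →ₗ[ℝ] ℝ) (η : V →ₗ[ℝ] ℝ)
  | inf : CCell y η
  | face (S : Set J) (hS : IsFace y η S) : CCell y η

namespace CCell

variable {y : J → V →ₗ[ℝ] ℝ} {η : V →ₗ[ℝ] ℝ} {S E : Set J}

/-- Inclusion of closed cells. -/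
def Le : CCell y η → CCell y η → Prop
  | inf, inf => True
  | inf, face S _ => IsUnb y η S
  | face _ _, inf => False
  | face S _, face S' _ => S ⊆ S'

instance : PartialOrder (CCell y η) where
  le := Le
  le_refl a := by cases a <;> simp [Le]
  le_trans a b c h1 h2 := by
    cases a <;> cases b <;> cases c <;> simp only [Le] at h1 h2 ⊢
    exacts [h2, h1.mono h2, h1.trans h2]
  le_antisymm a b h1 h2 := by
    cases a <;> cases b <;> simp only [Le] at h1 h2 ⊢
    congr
    exact h1.antisymm h2

/-- The dimension of a cell. -/
noncomputable def dim : CCell y η → ℕ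
  | inf => 0
  | face S _ => finrank ℝ (flat y S) - 1

theorem face_le_face {hS : IsFace y η S} {hE : IsFace y η E} : face E hE ≤ face S hS ↔ E ⊆ S :=
  Iff.rfl

theorem face_inj {hS : IsFace y η S} {hE : IsFace y η E} : face E hE = face S hS ↔ E = S :=
  ⟨fun h => by injection h, fun h => by subst h; rfl⟩

theorem inf_le_face {hS : IsFace y η S} : inf ≤ face S hS ↔ IsUnb y η S := Iff.rfl

theorem not_face_le_inf {hS : IsFace y η S} : ¬ face S hS ≤ inf := id

theorem face_lt_face {hS : IsFace y η S} {hE : IsFace y η E} : face E hE < face S hS ↔ E ⊂ S :=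
  Iff.rfl

theorem inf_lt_face {hS : IsFace y η S} : inf < face S hS ↔ IsUnb y η S := by
  rw [lt_iff_le_not_ge, inf_le_face]
  exact and_iff_left not_face_le_inf

theorem not_lt_inf {a : CCell y η} : ¬ a < inf := by
  cases a
  · exact lt_irrefl _
  · exact fun h => not_face_le_inf h.le

instance [Finite J] : Finite (CCell y η) :=
  Finite.of_surjective (α := Option {S // IsFace y η S})
    (fun o => o.elim inf fun S => face S.1 S.2) fun a => by
      cases a with
      | inf => exact ⟨none, rfl⟩
      | face S hS => exact ⟨some ⟨S, hS⟩, rfl⟩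

theorem dim_eq_zero_of_lt [FiniteDimensional ℝ V] {hS : IsFace y η S}
    (hd : finrank ℝ (flat y S) = 2) (a : CCell y η) (ha : a < face S hS) : dim a = 0 := by
  cases a with
  | inf => rfl
  | face E hE =>
    have := hS.finrank_lt (face_lt_face.1 ha)
    simp only [dim]; omega

end CCell

open CCell

variable {y : J → V →ₗ[ℝ] ℝ} {η : V →ₗ[ℝ] ℝ} {S E F G : Set J}

section

variable {p q : V} {key : Set J → ℝ}

/-- `key F` is the parameter at which the line through `p` in direction `q` meets the span of the
facet `F`. -/
theorem sub_smul_mem_flat (hkey : ∀ G, IsFacet y η G S → ∀ i ∉ G, y i p = key G * y i q)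
    (hF : IsFacet y η F S) : p - key F • q ∈ flat y F :=
  mem_flat.2 fun i hi => by simp [hkey F hF i hi]

variable [FiniteDimensional ℝ V]

/-- When the line reaches the span of `F` it has already crossed that of `G`, so the meeting point
lies outside the face `F`, on the far side of `G`. -/
theorem exists_neg_of_key_lt (hq : ∀ i ∈ S, 0 < y i q)
    (hkey : ∀ G, IsFacet y η G S → ∀ i ∉ G, y i p = key G * y i q)
    (hF : IsFacet y η F S) (hG : IsFacet y η G S) (h : key G < key F) :
    ∃ i ∈ F, i ∉ G ∧ y i (p - key F • q) < 0 := by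
  obtain ⟨i, hiF, hiG⟩ := hF.not_subset hG fun he => by simp [he] at h
  refine ⟨i, hiF, hiG, ?_⟩
  simp only [map_sub, map_smul, smul_eq_mul, hkey G hG i hiG, ← sub_mul]
  exact mul_neg_of_neg_of_pos (by linarith) (hq i (hF.2.1 hiF))

/-- The span of an unbounded face contains a nonzero vector of height zero and a vector of positive
height. -/
theorem IsFace.two_le_finrank (hy : IsTruncated y η) (hS : IsFace y η S) (hu : IsUnb y η S) :
    2 ≤ finrank ℝ (flat y S) := by
  obtain ⟨q, hqS, hq, hηq⟩ := hS.exists_height_eq_zero hu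
  obtain ⟨z, hz, hz', hηz⟩ := id hS
  have hlt : flat y S ⊓ LinearMap.ker η < flat y S := by
    refine lt_of_le_of_ne inf_le_left fun he => hηz.ne' ?_
    exact (he.symm ▸ (mem_flat.2 hz' : z ∈ flat y S) : z ∈ flat y S ⊓ LinearMap.ker η).2
  have hpos : 0 < finrank ℝ (flat y S ⊓ LinearMap.ker η : Submodule ℝ V) := by
    rw [Module.finrank_pos_iff_exists_ne_zero]
    refine ⟨⟨q, hqS, hηq⟩, fun h => ?_⟩
    have hq0 : q = 0 := congrArg Subtype.val h
    have hSe : ∀ i, i ∉ S := fun i hi => by simpa [hq0] using hq i hi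
    have hz0 := hy.pointed z fun i => hz' i (hSe i)
    simp [hz0] at hηz
  have := Submodule.finrank_lt_finrank_of_lt hlt
  omega

end

section

variable [Finite J]

/-- The last condition says that distinct facets are met by the line at distinct parameters, so that
they can be totally ordered. -/
theorem exists_generic_interior (hy : IsTruncated y η) (hS : IsFace y η S)
    (hd : 3 ≤ finrank ℝ (flat y S)) {p : V}
    (hp : ∀ G, IsFacet y η G S → ∀ i ∈ S \ G, y i p ≠ 0) :
    ∃ q ∈ flat y S, (∀ i ∈ S, 0 < y i q) ∧ (IsUnb y η S → η q = 0) ∧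
      ∀ G G', IsFacet y η G S → IsFacet y η G' S → G ≠ G' → ∀ i ∈ S \ G, ∀ j ∈ G \ G',
        y i p * y j q ≠ y j p * y i q := by
  classical
  -- `U` is where `q` may vary: all of `flat y S`, or its height-zero part if `S` is unbounded. In
  -- the latter case a vector with `l v ≠ 0` is corrected to height zero by a multiple of `v₀`,
  -- which does not change `l`.
  obtain ⟨U, hUS, hU, hUη, hgen⟩ : ∃ U : Submodule ℝ V, U ≤ flat y S ∧
      (∃ q ∈ U, ∀ i ∈ S, 0 < y i q) ∧ (IsUnb y η S → ∀ q ∈ U, η q = 0) ∧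
      ∀ l : V →ₗ[ℝ] ℝ, (∃ v ∈ flat y S, l v ≠ 0) → ∀ v₀ ∈ flat y S, l v₀ = 0 → η v₀ ≠ 0 →
        ∃ v ∈ U, l v ≠ 0 := by
    by_cases hu : IsUnb y η S
    · obtain ⟨q, hqS, hq, hηq⟩ := hS.exists_height_eq_zero hu
      refine ⟨flat y S ⊓ LinearMap.ker η, inf_le_left, ⟨q, ⟨hqS, hηq⟩, hq⟩, fun _ q hq => hq.2, ?_⟩
      rintro l ⟨v, hv, hlv⟩ v₀ hv₀ hl₀ hη₀
      refine ⟨v - (η v / η v₀) • v₀, ⟨sub_mem hv (Submodule.smul_mem _ _ hv₀), ?_⟩, ?_⟩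
      · simp [div_mul_cancel₀ _ hη₀]
      · simpa [hl₀] using hlv
    · obtain ⟨z, hz, hz', -⟩ := id hS
      exact ⟨flat y S, le_rfl, ⟨z, mem_flat.2 hz', hz⟩, fun h => absurd h hu, fun l h _ _ _ _ => h⟩
  obtain ⟨q, hqU, hq, hΛ⟩ := exists_generic y U (K := S)
    {l | (∃ v ∈ U, l v ≠ 0) ∧ ∃ i j, l = y i p • y j - y j p • y i}
    ((Set.finite_range fun ij : J × J => y ij.1 p • y ij.2 - y ij.2 p • y ij.1).subset (by
      rintro _ ⟨-, i, j, rfl⟩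
      exact ⟨(i, j), rfl⟩)) hU (fun l hl => hl.1)
  refine ⟨q, hUS hqU, hq, fun hu => hUη hu q hqU, fun G G' hG hG' hne i hi j hj h => ?_⟩
  obtain ⟨v₀, hv₀, hi₀, hj₀, hη₀⟩ := hy.generic S hS hd i j
  obtain ⟨g, hg, hg', -⟩ := id hG.1
  refine hΛ (y i p • y j - y j p • y i) ⟨hgen _ ⟨g, flat_mono hG.2.1 (mem_flat.2 hg'), ?_⟩ v₀ hv₀
    (by simp [hi₀, hj₀]) hη₀, i, j, rfl⟩ (by simp [h])
  simp only [LinearMap.sub_apply, LinearMap.smul_apply, smul_eq_mul, hg' i hi.2, mul_zero, sub_zero]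
  exact mul_ne_zero (hp G hG i hi) (hg j hj.1).ne'

end

variable [Finite J] [FiniteDimensional ℝ V]

/-- The proper faces of a one-dimensional cell are points, possibly with infinity among them. Every
order of them is a shelling, so an arbitrary set `X` may come first. -/
theorem exists_orderShelling_of_finrank_eq_two (hy : IsTruncated y η) (hS : IsFace y η S)
    (hd : finrank ℝ (flat y S) = 2) (X : Set (CCell y η)) (hX : X ⊆ Set.Iio (face S hS)) :
    ∃ l, OrderShelling dim (Set.Iio (face S hS)) l ∧ ∃ m, ∀ τ, τ ∈ l.take m ↔ τ ∈ X := by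
  classical
  have hmax : ∀ σ, Maximal (· ∈ Set.Iio (face S hS)) σ ↔ σ ∈ Set.Iio (face S hS) := by
    intro σ
    refine ⟨fun h => h.prop, fun h => ⟨h, fun τ hτ hστ => ?_⟩⟩
    by_contra hne
    have hlt : σ < τ := lt_of_le_not_ge hστ hne
    cases τ with
    | inf => exact not_lt_inf hlt
    | face E hE =>
      have h1 := hS.finrank_lt (face_lt_face.1 hτ)
      cases σ with
      | inf => exact absurd (hE.two_le_finrank hy (inf_lt_face.1 hlt)) (by omega)
      | face A hA =>
        have := hE.finrank_lt (face_lt_face.1 hlt)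
        have := hA.finrank_pos
        omega
  have hXf : X.Finite := Set.toFinite X
  have hYf : (Set.Iio (face S hS) \ X).Finite := Set.toFinite _
  refine ⟨hXf.toFinset.toList ++ hYf.toFinset.toList, .zero _ _ ?_ ?_ (dim_eq_zero_of_lt hd),
    hXf.toFinset.toList.length, fun τ => by simp⟩
  · refine List.Nodup.append (Finset.nodup_toList _) (Finset.nodup_toList _) ?_
    intro a ha hb
    simp only [Finset.mem_toList, Set.Finite.mem_toFinset] at ha hb
    exact hb.2 ha
  · intro σ
    simp only [hmax, List.mem_append, Finset.mem_toList, Set.Finite.mem_toFinset, Set.mem_sdiff]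
    constructor
    · rintro (h | h)
      exacts [hX h, h.1]
    · intro h
      by_cases hx : σ ∈ X
      exacts [Or.inl hx, Or.inr ⟨h, hx⟩]

/-- The maximal cells of the boundary of a face of dimension at least two are its facets. -/
theorem maximal_Iio_face_iff (hy : IsTruncated y η) (hS : IsFace y η S)
    (hd : 3 ≤ finrank ℝ (flat y S)) (τ : CCell y η) :
    Maximal (· ∈ Set.Iio (face S hS)) τ ↔ ∃ E hE, τ = face E hE ∧ IsFacet y η E S := by
  constructor
  · intro h
    cases τ with
    | inf =>
      have hu : IsUnb y η S := inf_lt_face.1 h.prop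
      obtain ⟨q, hqS, hq, hηq⟩ := hS.exists_height_eq_zero hu
      have hS0 : ∃ i, i ∈ S := by
        by_contra! h0
        obtain ⟨z, hz, hz', hηz⟩ := hS
        simp [hy.pointed z fun i => hz' i (h0 i)] at hηz
      obtain ⟨i, hi⟩ := hS0
      -- The point `-q` of height zero sees an unbounded facet, so infinity is not maximal.
      obtain ⟨E, hE, hEu, -⟩ := hS.exists_visible_unb hy hu hd (p := -q) (neg_mem hqS)
        (by simp [hηq]) ⟨i, hi, by simpa using hq i hi⟩
      exact absurd (h.le_of_ge (y := face E hE.1) (face_lt_face.2 hE.ssubset)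
        (inf_le_face.2 hEu)) not_face_le_inf
    | face A hA =>
      obtain ⟨E, hE, hAE⟩ := hA.exists_facet hS (face_lt_face.1 h.prop)
      have := face_le_face.1 (h.le_of_ge (y := face E hE.1) (face_lt_face.2 hE.ssubset)
        (face_le_face.2 hAE))
      obtain rfl := hAE.antisymm this
      exact ⟨A, hA, rfl, hE⟩
  · rintro ⟨E, hE, rfl, hEf⟩
    refine ⟨face_lt_face.2 hEf.ssubset, fun τ hτ hle => ?_⟩
    cases τ with
    | inf => exact absurd hle not_face_le_inf
    | face A hA =>
      have h1 := hS.finrank_lt (face_lt_face.1 hτ)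
      have h2 := hA.eq_of_subset (face_le_face.1 hle) (by have := hEf.2.2; omega)
      exact face_le_face.2 h2.ge

/-- Cells shared by the boundary of the facet `F` of `S` with an earlier facet, with respect to the
order of the facets given by `key`. -/
def attachingFacet (y : J → V →ₗ[ℝ] ℝ) (η : V →ₗ[ℝ] ℝ) (S : Set J) (key : Set J → ℝ)
    (F : Set J) (hF : IsFace y η F) : Set (CCell y η) :=
  {τ | τ < face F hF ∧ ∃ G hG, IsFacet y η G S ∧ key G < key F ∧ τ < face G hG}

section Attaching

variable {p q : V} {key : Set J → ℝ}

/-- The facet `E` of `F` lies in exactly the kind of second facet `G` that decides the matter: on `F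
\ G` the sign of `y i (p - key F • q)` is the sign of `key G - key F`, so visibility of `E` makes
`G` earlier. -/
theorem visible_mem_attachingFacet (hS : IsFace y η S) (hq : ∀ i ∈ S, 0 < y i q)
    (hkey : ∀ G, IsFacet y η G S → ∀ i ∉ G, y i p = key G * y i q)
    (hF : IsFacet y η F S) (hE : IsFacet y η E F)
    (hv : ∀ k ∈ F \ E, y k (p - key F • q) < 0) :
    face E hE.1 ∈ attachingFacet y η S key F hF.1 := by
  obtain ⟨G, hG, hGF, hEG⟩ := hE.exists_ne hF hS
  obtain ⟨i, hiF, hiG⟩ := hF.not_subset hG hGF.symm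
  obtain ⟨j, hjG, hjF⟩ := hG.not_subset hF hGF
  refine ⟨face_lt_face.2 hE.ssubset, G, hG.1, hG, ?_, face_lt_face.2 ?_⟩
  · have h1 := hv i ⟨hiF, fun h => hiG (hEG h)⟩
    simp only [map_sub, map_smul, smul_eq_mul, hkey G hG i hiG, ← sub_mul] at h1
    have h2 := hq i (hF.2.1 hiF)
    by_contra! h
    exact absurd h1 (not_lt.2 (mul_nonneg (by linarith) h2.le))
  · exact Set.ssubset_iff_exists.2 ⟨hEG, j, hjG, fun h => hjF (hE.2.1 h)⟩

/-- This also covers one-dimensional `F`, to which `maximal_attachingFacet_iff` does not apply. -/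
theorem attachingFacet_nonempty (hy : IsTruncated y η) (hS : IsFace y η S)
    (hq : ∀ i ∈ S, 0 < y i q)
    (hkey : ∀ G, IsFacet y η G S → ∀ i ∉ G, y i p = key G * y i q)
    (hF : IsFacet y η F S) (hηp : IsUnb y η F → η (p - key F • q) = 0)
    (hd : 2 ≤ finrank ℝ (flat y F)) (hG : IsFacet y η G S) (h : key G < key F) :
    (attachingFacet y η S key F hF.1).Nonempty := by
  obtain ⟨i, hiF, -, hi⟩ := exists_neg_of_key_lt hq hkey hF hG h
  obtain ⟨E, hE, hv⟩ := hF.1.exists_visible_facet hy hd (sub_smul_mem_flat hkey hF) hηp ⟨i, hiF, hi⟩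
  exact ⟨_, visible_mem_attachingFacet hS hq hkey hF hE hv⟩

/-- The core of the line shelling. A cell shared with an earlier facet `G` misses some `i ∈ F \ G`
at which the meeting point is negative. That point thus violates the local cone of `F` at the cell
and sees a facet of `F` containing it, and such a facet is itself shared. For the cell at infinity
`exists_visible_unb` supplies the facet. -/
theorem maximal_attachingFacet_iff (hy : IsTruncated y η) (hS : IsFace y η S)
    (hq : ∀ i ∈ S, 0 < y i q)
    (hkey : ∀ G, IsFacet y η G S → ∀ i ∉ G, y i p = key G * y i q)
    (hF : IsFacet y η F S) (hηp : IsUnb y η F → η (p - key F • q) = 0)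
    (hd : 3 ≤ finrank ℝ (flat y F)) (τ : CCell y η) :
    Maximal (· ∈ attachingFacet y η S key F hF.1) τ ↔
      ∃ E hE, τ = face E hE ∧ IsFacet y η E F ∧ ∀ k ∈ F \ E, y k (p - key F • q) < 0 := by
  constructor
  · intro hτ
    obtain ⟨h1, G, hGf, hG, hlt, h2⟩ := hτ.prop
    obtain ⟨i, hiF, hiG, hi⟩ := exists_neg_of_key_lt hq hkey hF hG hlt
    have hpF := sub_smul_mem_flat hkey hF
    obtain ⟨E, hE, hle, hv⟩ : ∃ E, ∃ hE : IsFacet y η E F, τ ≤ face E hE.1 ∧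
        ∀ k ∈ F \ E, y k (p - key F • q) < 0 := by
      cases τ with
      | inf =>
        obtain ⟨E, hE, hu, hv⟩ := hF.1.exists_visible_unb hy (inf_lt_face.1 h1) hd hpF
          (hηp (inf_lt_face.1 h1)) ⟨i, hiF, hi⟩
        exact ⟨E, hE, inf_le_face.2 hu, hv⟩
      | face A hA =>
        obtain ⟨E, hE, hAE, hv⟩ := hA.exists_visible hF.1 (face_lt_face.1 h1).subset hpF
          ⟨i, ⟨hiF, fun h => hiG ((face_lt_face.1 h2).subset h)⟩, hi⟩
        exact ⟨E, hE, face_le_face.2 hAE, hv⟩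
    exact ⟨E, hE.1, le_antisymm hle
      (hτ.le_of_ge (visible_mem_attachingFacet hS hq hkey hF hE hv) hle), hE, hv⟩
  · rintro ⟨E, hEf, rfl, hE, hv⟩
    refine ⟨visible_mem_attachingFacet hS hq hkey hF hE hv, fun τ hτ hle => ?_⟩
    exact ((maximal_Iio_face_iff hy hF.1 hd _).2 ⟨E, hEf, rfl, hE⟩).le_of_ge hτ.1 hle

end Attaching

/-- The prescribed initial segment is what makes the induction work: in the boundary of a facet `F`,
the shelling required by the definition must begin with the facets visible from `p - key F • q`. -/
theorem exists_orderShelling_visible (hy : IsTruncated y η) (n : ℕ) :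
    ∀ (S : Set J) (hS : IsFace y η S) (_ : finrank ℝ (flat y S) = n) (_ : 3 ≤ n) (p : V)
      (_ : p ∈ flat y S) (_ : IsUnb y η S → η p = 0)
      (_ : ∀ G, IsFacet y η G S → ∀ i ∈ S \ G, y i p ≠ 0),
      ∃ l, OrderShelling dim (Set.Iio (face S hS)) l ∧ ∃ m, ∀ τ, τ ∈ l.take m ↔
        ∃ E hE, τ = face E hE ∧ IsFacet y η E S ∧ ∀ k ∈ S \ E, y k p < 0 := by
  classical
  induction n with
  | zero => intro _ _ _ h; omega
  | succ n ih =>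
  intro S hS hn hd p hp hηp hpG
  rw [← hn] at hd
  obtain ⟨q, hqS, hq, hηq, hgen⟩ := exists_generic_interior hy hS hd hpG
  have hkey : ∀ G, IsFacet y η G S → ∃ c : ℝ, ∀ i ∉ G, y i p = c * y i q := by
    intro G hG
    obtain ⟨i, hiS, hiG⟩ := Set.exists_of_ssubset hG.ssubset
    have h0 := (hq i hiS).ne'
    refine ⟨y i p / y i q, fun k hk => ?_⟩
    have := hG.mul_eq_mul hp hqS hiG hk hS
    field_simp
    linarith
  choose! key hkey using hkey
  have hinj : ∀ G G', IsFacet y η G S → IsFacet y η G' S → key G = key G' → G = G' := by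
    intro G G' hG hG' h
    by_contra hne
    obtain ⟨i, hiS, hiG⟩ := Set.exists_of_ssubset hG.ssubset
    obtain ⟨j, hjG, hjG'⟩ := hG.not_subset hG' hne
    refine hgen G G' hG hG' hne i ⟨hiS, hiG⟩ j ⟨hjG, hjG'⟩ ?_
    rw [hkey G hG i hiG, hkey G' hG' j hjG', h]; ring
  -- the order of the facets
  let supp : CCell y η → Set J := fun a => match a with
    | inf => ∅
    | face S _ => S
  obtain ⟨l, hld, hlm, hlp⟩ := exists_list_pairwise_lt
    (s := {τ : CCell y η | ∃ E hE, τ = face E hE ∧ IsFacet y η E S}) (Set.toFinite _)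
    (fun τ => key (supp τ)) (by
      rintro _ ⟨E, hE, rfl, hE'⟩ _ ⟨F, hF, rfl, hF'⟩ h
      obtain rfl := hinj E F hE' hF' h
      rfl)
  -- Since `y k p = key E * y k q` with `y k q > 0`, the facets visible from `p` are those of
  -- negative key.
  obtain ⟨m, hm⟩ := exists_take_iff_lt hlp 0
  have hηF : ∀ F, IsFacet y η F S → IsUnb y η F → η (p - key F • q) = 0 := fun F hF hu => by
    simp [hηp (hu.mono hF.2.1), hηq (hu.mono hF.2.1)]
  have hsplit : ∀ l₁ σ l₂, l = l₁ ++ σ :: l₂ → l₁ ≠ [] → ∃ F, ∃ hF : IsFacet y η F S,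
      σ = face F hF.1 ∧ (∃ G, IsFacet y η G S ∧ key G < key F) ∧
      attaching l₁ σ = attachingFacet y η S key F hF.1 := by
    intro l₁ σ l₂ h hne
    obtain ⟨F, hF, rfl, hFf⟩ := (hlm σ).1 (by simp [h])
    have hl₁ := fun τ => mem_left_iff_of_pairwise_lt hlp h τ
    refine ⟨F, hFf, rfl, ?_, ?_⟩
    · obtain ⟨τ, hτ⟩ := List.exists_mem_of_ne_nil _ hne
      obtain ⟨h1, h2⟩ := (hl₁ τ).1 hτ
      obtain ⟨G, hG, rfl, hGf⟩ := (hlm τ).1 h1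
      exact ⟨G, hGf, h2⟩
    · ext τ
      simp only [attaching, attachingFacet, Set.mem_inter_iff, Set.mem_Iio, Set.mem_iUnion,
        Set.mem_ofPred_eq, exists_prop]
      refine and_congr_right fun _ => ⟨?_, ?_⟩
      · rintro ⟨ρ, hρ, hlt⟩
        obtain ⟨h1, h2⟩ := (hl₁ ρ).1 hρ
        obtain ⟨G, hG, rfl, hGf⟩ := (hlm ρ).1 h1
        exact ⟨G, hG, hGf, h2, hlt⟩
      · rintro ⟨G, hG, hGf, h2, hlt⟩
        exact ⟨face G hG, (hl₁ _).2 ⟨(hlm _).2 ⟨G, hG, rfl, hGf⟩, h2⟩, hlt⟩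
  have hLF : ∀ F, ∀ hF : IsFacet y η F S, ∃ lF, OrderShelling dim (Set.Iio (face F hF.1)) lF ∧
      ∃ k : ℕ, ∀ τ, τ ∈ lF.take k ↔ Maximal (· ∈ attachingFacet y η S key F hF.1) τ := by
    intro F hF
    have hdF := hF.2.2
    by_cases h2 : finrank ℝ (flat y F) = 2
    · exact exists_orderShelling_of_finrank_eq_two hy hF.1 h2 {τ | Maximal _ τ}
        fun τ hτ => hτ.prop.1
    · simp only [maximal_attachingFacet_iff hy hS hq hkey hF (hηF F hF) (by omega)]
      refine ih F hF.1 (by omega) (by omega) _ (sub_smul_mem_flat hkey hF) (hηF F hF) ?_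
      -- The second facet `G` through `E` has a different key. On the span of `F` the functionals
      -- vanishing on `E` are proportional, so a zero of `y i` at the meeting point would force `key
      -- G = key F`.
      intro E hE i hi h0
      obtain ⟨G, hG, hGF, hEG⟩ := hE.exists_ne hF hS
      obtain ⟨k, hkF, hkG⟩ := hF.not_subset hG hGF.symm
      have h1 := hE.mul_eq_mul (sub_smul_mem_flat hkey hF)
        (mem_flat.2 (Classical.choose_spec hF.1).2.1) hi.2 (fun h => hkG (hEG h)) hF.1
      rw [h0, zero_mul] at h1
      have h3 := (Classical.choose_spec hF.1).1 i hi.1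
      have h4 : y k (p - key F • q) = 0 := by
        rcases mul_eq_zero.1 h1.symm with h | h
        exacts [h, absurd h h3.ne']
      simp only [map_sub, map_smul, smul_eq_mul, hkey G hG k hkG, ← sub_mul] at h4
      rcases mul_eq_zero.1 h4 with h | h
      · exact hGF (hinj G F hG hF (sub_eq_zero.1 h))
      · exact (hq k (hF.2.1 hkF)).ne' h
  choose! lF hlF kF hkF using hLF
  refine ⟨l, .step _ _ hld (fun σ => (hlm σ).trans (maximal_Iio_face_iff hy hS hd σ).symm)
    (fun τ => lF (supp τ)) ?_ ?_ ?_, m, fun τ => ?_⟩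
  · intro σ hσ
    obtain ⟨F, hF, rfl, hFf⟩ := (hlm σ).1 hσ
    exact hlF F hFf
  · intro l₁ σ l₂ h hne
    obtain ⟨F, hF, rfl, ⟨G, hG, hlt⟩, hat⟩ := hsplit l₁ σ l₂ h hne
    rw [hat]
    have hdF := hF.2.2
    refine ⟨attachingFacet_nonempty hy hS hq hkey hF (hηF F hF) (by omega) hG hlt,
      fun τ hτ => ?_⟩
    by_cases h2 : finrank ℝ (flat y F) = 2
    · rw [dim_eq_zero_of_lt h2 τ hτ.prop.1]
      simp [dim, h2]
    · obtain ⟨E, hE, rfl, hEf, -⟩ :=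
        (maximal_attachingFacet_iff hy hS hq hkey hF (hηF F hF) (by omega) τ).1 hτ
      have := hEf.2.2
      simp only [dim]
      omega
  · intro l₁ σ l₂ h hne
    obtain ⟨F, hF, rfl, -, hat⟩ := hsplit l₁ σ l₂ h hne
    rw [hat]
    exact ⟨kF F, hkF F hF⟩
  · rw [hm, hlm]
    constructor
    · rintro ⟨⟨E, hE, rfl, hEf⟩, h⟩
      refine ⟨E, hE, rfl, hEf, fun k hk => ?_⟩
      rw [hkey E hEf k hk.2]
      exact mul_neg_of_neg_of_pos h (hq k hk.1)
    · rintro ⟨E, hE, rfl, hEf, hv⟩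
      refine ⟨⟨E, hE, rfl, hEf⟩, ?_⟩
      obtain ⟨i, hiS, hiE⟩ := Set.exists_of_ssubset hEf.ssubset
      have := hv i ⟨hiS, hiE⟩
      rw [hkey E hEf i hiE] at this
      by_contra! h
      exact absurd this (not_lt.2 (mul_nonneg h (hq i hiS).le))

/-- The boundary complex of the compactification of a polyhedron of positive dimension is
shellable. -/
theorem exists_orderShelling (hy : IsTruncated y η) (hS : IsFace y η S)
    (hd : 2 ≤ finrank ℝ (flat y S)) : ∃ l, OrderShelling dim (Set.Iio (face S hS)) l := by
  rcases hd.eq_or_lt with hd | hd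
  · obtain ⟨l, hl, -⟩ := exists_orderShelling_of_finrank_eq_two hy hS hd.symm ∅ (by simp)
    exact ⟨l, hl⟩
  -- A relatively interior point lies on no facet hyperplane. It sees no facet, so the prescribed
  -- initial segment is empty.
  obtain ⟨p, hp, hp', hη⟩ : ∃ p ∈ flat y S, (∀ i ∈ S, 0 < y i p) ∧ (IsUnb y η S → η p = 0) := by
    by_cases hu : IsUnb y η S
    · obtain ⟨q, hqS, hq, hηq⟩ := hS.exists_height_eq_zero hu
      exact ⟨q, hqS, hq, fun _ => hηq⟩
    · obtain ⟨z, hz, hz', -⟩ := id hS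
      exact ⟨z, mem_flat.2 hz', hz, fun h => absurd h hu⟩
  obtain ⟨l, hl, -⟩ := exists_orderShelling_visible hy _ S hS rfl hd p hp hη
    fun G _ i hi => (hp' i hi.1).ne'
  exact ⟨l, hl⟩

end ConeShelling

end

/-! ### The one-point compactification of an unbounded convex set is a ball. -/

section

open Module Filter Topology

namespace ConvexCell

section Inversion

variable {E : Type*} [NormedAddCommGroup E] [NormedSpace ℝ E]

/-- A closed convex set with a recession direction `c`, on which the norm is dominated by a
positive affine functional `h + κ`. -/
structure Data (P : Set E) (h : E →L[ℝ] ℝ) (κ : ℝ) (c : E) : Prop where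
  closed : IsClosed P
  convex : Convex ℝ P
  nonempty_interior : (interior P).Nonempty
  apply_dir : h c = 1
  add_mem : ∀ x ∈ P, ∀ t : ℝ, 0 ≤ t → x + t • c ∈ P
  one_le : ∀ x ∈ P, 1 ≤ h x + κ
  norm_le : ∃ C, ∀ x ∈ P, ‖x‖ ≤ C * (h x + κ)

/-- The inversion mapping the point at infinity to the origin. -/
noncomputable def toBody (h : E →L[ℝ] ℝ) (κ : ℝ) (c x : E) : E := ((h x + κ) ^ 2)⁻¹ • (x + (1 - h x) • c)

/-- The inverse of `toBody`. -/
noncomputable def ofBody (h : E →L[ℝ] ℝ) (κ : ℝ) (c z : E) : E := (h z)⁻¹ • z + ((√(h z))⁻¹ - 1 - κ) • c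

/-- The convex body obtained from `P` by adding a point at infinity. -/
def body (P : Set E) (h : E →L[ℝ] ℝ) (κ : ℝ) (c : E) : Set E :=
  {z | z = 0 ∨ 0 < h z ∧ ofBody h κ c z ∈ P}

variable {P : Set E} {h : E →L[ℝ] ℝ} {κ : ℝ} {c : E}

theorem apply_toBody (hc : h c = 1) (x : E) : h (toBody h κ c x) = ((h x + κ) ^ 2)⁻¹ := by
  simp [toBody, hc, ← mul_add]

theorem apply_ofBody (hc : h c = 1) {z : E} (hz : 0 < h z) :
    h (ofBody h κ c z) + κ = (√(h z))⁻¹ := by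
  simp only [ofBody, map_add, map_smul, smul_eq_mul, hc, inv_mul_cancel₀ hz.ne']
  ring

theorem ofBody_toBody (hc : h c = 1) {x : E} (hx : 0 < h x + κ) :
    ofBody h κ c (toBody h κ c x) = x := by
  rw [ofBody, apply_toBody hc, Real.sqrt_inv, Real.sqrt_sq hx.le, inv_inv, inv_inv, toBody,
    smul_smul, mul_inv_cancel₀ (by positivity), one_smul, add_assoc, ← add_smul]
  rw [show 1 - h x + (h x + κ - 1 - κ) = 0 by ring, zero_smul, add_zero]

theorem toBody_ofBody (hc : h c = 1) {z : E} (hz : 0 < h z) :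
    toBody h κ c (ofBody h κ c z) = z := by
  have h1 := apply_ofBody (κ := κ) hc hz
  have h2 : h (ofBody h κ c z) = (√(h z))⁻¹ - κ := by linarith
  rw [toBody, h1, inv_pow, Real.sq_sqrt hz.le, inv_inv, h2, ofBody, add_assoc, ← add_smul]
  rw [show (√(h z))⁻¹ - 1 - κ + (1 - ((√(h z))⁻¹ - κ)) = 0 by ring, zero_smul, add_zero, smul_smul,
    mul_inv_cancel₀ hz.ne', one_smul]

theorem continuousAt_ofBody {z : E} (hz : 0 < h z) : ContinuousAt (ofBody h κ c) z := by
  have h1 : ContinuousAt (fun z => (h z)⁻¹) z := h.continuous.continuousAt.inv₀ hz.ne'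
  have h2 : ContinuousAt (fun z => (√(h z))⁻¹) z :=
    (Real.continuous_sqrt.comp h.continuous).continuousAt.inv₀ (Real.sqrt_pos.2 hz).ne'
  exact (h1.smul continuousAt_id).add (((h2.sub continuousAt_const).sub continuousAt_const).smul
    continuousAt_const)

theorem continuousAt_toBody {x : E} (hx : 0 < h x + κ) : ContinuousAt (toBody h κ c) x := by
  have h1 : ContinuousAt (fun x => ((h x + κ) ^ 2)⁻¹) x :=
    ((h.continuous.add continuous_const).pow 2).continuousAt.inv₀ (pow_pos hx 2).ne'
  exact h1.smul (by fun_prop)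

theorem toBody_mem_body (hc : h c = 1) {x : E} (hx : 0 < h x + κ) (hP : x ∈ P) :
    toBody h κ c x ∈ body P h κ c :=
  Or.inr ⟨by rw [apply_toBody hc]; positivity, by rwa [ofBody_toBody hc hx]⟩

theorem Data.smul_mem_body (hD : Data P h κ c) {z : E} (hz : z ∈ body P h κ c) {a : ℝ} (ha : 0 < a)
    (ha1 : a ≤ 1) : a • z ∈ body P h κ c := by
  rcases hz with rfl | ⟨hz, hP⟩
  · exact Or.inl (smul_zero a)
  · refine Or.inr ⟨by simpa using mul_pos ha hz, ?_⟩
    have h1 := hD.add_mem _ hP ((√(a * h z))⁻¹ - (√(h z))⁻¹) (sub_nonneg.2 ?_)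
    · convert h1 using 1
      simp only [ofBody, map_smul, smul_eq_mul, smul_smul, mul_inv]
      rw [mul_right_comm, inv_mul_cancel₀ ha.ne', one_mul, add_assoc, ← add_smul]
      congr 2
      ring
    · gcongr
      exact mul_le_of_le_one_left hz.le ha1

/-- The preimage of `a • z + b • w` is a convex combination of the preimages, with weights
proportional to `a * h z` and `b * h w`, plus a multiple of `c`. Concavity of the square root makes
that multiple nonnegative, and `P` is stable under adding such multiples. -/
theorem Data.convex_body (hD : Data P h κ c) : Convex ℝ (body P h κ c) := by
  rw [convex_iff_forall_pos]
  intro z hz w hw a b ha hb hab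
  rcases id hz with rfl | ⟨hz0, hzP⟩
  · simpa using hD.smul_mem_body hw hb (by linarith)
  rcases id hw with rfl | ⟨hw0, hwP⟩
  · simpa using hD.smul_mem_body hz ha (by linarith)
  set r := a * h z + b * h w with hr
  have hr0 : 0 < r := by positivity
  have hhr : h (a • z + b • w) = r := by simp [hr]
  refine Or.inr ⟨by rw [hhr]; exact hr0, ?_⟩
  have h1 := hD.convex hzP hwP (a := a * h z / r) (b := b * h w / r) (by positivity)
    (by positivity) (by rw [← add_div, ← hr, div_self hr0.ne'])
  have h2 := hD.add_mem _ h1 ((√r)⁻¹ - (a * h z / r * (√(h z))⁻¹ + b * h w / r * (√(h w))⁻¹))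
    (sub_nonneg.2 ?_)
  · convert h2 using 1
    rw [ofBody, hhr, ofBody, ofBody]
    simp only [smul_add, smul_smul]
    rw [show a * h z / r * (h z)⁻¹ = r⁻¹ * a by field_simp,
      show b * h w / r * (h w)⁻¹ = r⁻¹ * b by field_simp]
    have h3 : (√r)⁻¹ - 1 - κ = a * h z / r * ((√(h z))⁻¹ - 1 - κ) +
        b * h w / r * ((√(h w))⁻¹ - 1 - κ) +
        ((√r)⁻¹ - (a * h z / r * (√(h z))⁻¹ + b * h w / r * (√(h w))⁻¹)) := by
      have : a * h z / r + b * h w / r = 1 := by rw [← add_div, ← hr, div_self hr0.ne']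
      linear_combination (1 + κ) * this
    rw [h3]
    module
  · have hsz := Real.sq_sqrt hz0.le
    have hsw := Real.sq_sqrt hw0.le
    have hsr := Real.sq_sqrt hr0.le
    have pz := Real.sqrt_pos.2 hz0
    have pw := Real.sqrt_pos.2 hw0
    have pr := Real.sqrt_pos.2 hr0
    have hconc := Real.strictConcaveOn_sqrt.concaveOn.2 (x := h z) (y := h w) hz0.le hw0.le
      ha.le hb.le hab
    simp only [smul_eq_mul, ← hr] at hconc
    have e1 : a * h z / r * (√(h z))⁻¹ = a * √(h z) / r := by
      field_simp; rw [hsz]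
    have e2 : b * h w / r * (√(h w))⁻¹ = b * √(h w) / r := by
      field_simp; rw [hsw]
    rw [e1, e2, ← add_div, div_le_iff₀ hr0]
    have e3 : (√r)⁻¹ * r = √r := by
      field_simp; rw [hsr]
    rw [e3]; exact hconc

theorem Data.nonneg_of_mem_body {z : E} (hz : z ∈ body P h κ c) : 0 ≤ h z := by
  rcases hz with rfl | ⟨hz, -⟩
  · simp
  · exact hz.le

/-- With `s = h x + κ`, the vector `x + (1 - h x) • c` is `O(s)`, and dividing by `s ^ 2` leaves
`O(1 / s) = O(√(h z))`. This is the purpose of the square in `toBody`: all directions at infinity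
collapse to the origin. -/
theorem Data.exists_norm_le (hD : Data P h κ c) :
    ∃ C, 0 ≤ C ∧ ∀ z ∈ body P h κ c, h z ≤ 1 ∧ ‖z‖ ≤ C * √(h z) := by
  obtain ⟨C, hC⟩ := hD.norm_le
  refine ⟨|C| + (1 + |κ|) * ‖c‖ + ‖c‖, by positivity, ?_⟩
  rintro z (rfl | ⟨hz, hP⟩)
  · simp
  set x := ofBody h κ c z with hx
  have hs := apply_ofBody (κ := κ) hD.apply_dir hz
  have h1 := hD.one_le x hP
  have hzx : z = toBody h κ c x := (toBody_ofBody hD.apply_dir hz).symm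
  set s := h x + κ with hs_def
  have hs0 : 0 < s := by linarith
  have hr : h z = (s ^ 2)⁻¹ := by rw [hzx, apply_toBody hD.apply_dir]
  have hsr : √(h z) = s⁻¹ := by rw [hr, Real.sqrt_inv, Real.sqrt_sq hs0.le]
  refine ⟨by rw [hr]; exact inv_le_one_of_one_le₀ (one_le_pow₀ h1), ?_⟩
  have hhx : |1 - h x| ≤ 1 + (1 + |κ|) * s := by
    have e : 1 - h x = 1 - s + κ := by rw [hs_def]; ring
    rw [e]
    have := abs_add_le (1 - s) κ
    have h3 : |1 - s| = s - 1 := by rw [abs_sub_comm]; exact abs_of_nonneg (by linarith)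
    have := abs_nonneg κ
    nlinarith
  have hb : ‖x + (1 - h x) • c‖ ≤ (|C| + (1 + |κ|) * ‖c‖ + ‖c‖) * s := by
    have e1 := norm_add_le x ((1 - h x) • c)
    rw [norm_smul, Real.norm_eq_abs] at e1
    have e2 := hC x hP
    have e3 : C * s ≤ |C| * s := mul_le_mul_of_nonneg_right (le_abs_self C) hs0.le
    have e4 := mul_le_mul_of_nonneg_right hhx (norm_nonneg c)
    have e5 := mul_le_mul_of_nonneg_right h1 (norm_nonneg c)
    nlinarith
  rw [hsr, hzx, toBody, norm_smul, Real.norm_eq_abs, abs_of_pos (by positivity)]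
  calc ((h x + κ) ^ 2)⁻¹ * ‖x + (1 - h x) • c‖ ≤ (s ^ 2)⁻¹ *
      ((|C| + (1 + |κ|) * ‖c‖ + ‖c‖) * s) := by gcongr
    _ = _ := by field_simp

/-- By the norm bound the only limit point with `h z = 0` is the origin. Where `h z > 0` the map
`ofBody` is continuous and `P` is closed. -/
theorem Data.isClosed_body (hD : Data P h κ c) : IsClosed (body P h κ c) := by
  obtain ⟨C, hC0, hC⟩ := hD.exists_norm_le
  refine isClosed_of_closure_subset fun z hz => ?_
  have hcl : z ∈ {z | 0 ≤ h z ∧ ‖z‖ ≤ C * √(h z)} := by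
    have hsub : body P h κ c ⊆ {z | 0 ≤ h z ∧ ‖z‖ ≤ C * √(h z)} := fun w hw =>
      ⟨Data.nonneg_of_mem_body hw, (hC w hw).2⟩
    refine closure_minimal hsub ?_ hz
    exact (isClosed_le continuous_const h.continuous).inter (isClosed_le continuous_norm
      (continuous_const.mul (Real.continuous_sqrt.comp h.continuous)))
  rcases hcl.1.eq_or_lt with h0 | h0
  · left
    have := hcl.2
    rw [← h0] at this
    simpa using this
  · refine Or.inr ⟨h0, hD.closed.closure_subset ?_⟩
    rw [mem_closure_iff_frequently] at hz ⊢
    refine (continuousAt_ofBody h0).frequently (hz.mp ?_)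
    filter_upwards [h.continuous.continuousAt.eventually (lt_mem_nhds h0)] with w hw hwK
    rcases hwK with rfl | ⟨-, hP⟩
    · simp at hw
    · exact hP

theorem Data.isBounded_body (hD : Data P h κ c) : Bornology.IsBounded (body P h κ c) := by
  obtain ⟨C, hC0, hC⟩ := hD.exists_norm_le
  refine isBounded_iff_forall_norm_le.2 ⟨C, fun z hz => ((hC z hz).2).trans ?_⟩
  exact mul_le_of_le_one_right hC0 (Real.sqrt_le_one.2 (hC z hz).1)

theorem Data.interior_body (hD : Data P h κ c) :
    interior (body P h κ c) = {z | 0 < h z ∧ ofBody h κ c z ∈ interior P} := by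
  ext z
  constructor
  · intro hz
    have hzK := interior_subset hz
    have h0 : 0 < h z := by
      rcases hzK with rfl | ⟨h0, -⟩
      swap
      · exact h0
      exfalso
      rw [mem_interior_iff_mem_nhds] at hz
      have hc : ContinuousAt (fun t : ℝ => -t • c) 0 := by fun_prop
      have h1 : ∀ᶠ t : ℝ in 𝓝 0, -t • c ∈ body P h κ c :=
        hc.preimage_mem_nhds (by
          have e : -(0 : ℝ) • c = 0 := by simp
          rw [e]; exact hz)
      -- The origin is not interior because `h` is nonnegative on the body but negative at `-t • c`.
      have h2 : ∀ᶠ t : ℝ in 𝓝[>] 0, -t • c ∈ body P h κ c := nhdsWithin_le_nhds h1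
      have h3 : ∀ᶠ t : ℝ in 𝓝[>] 0, 0 < t := self_mem_nhdsWithin
      obtain ⟨t, ht, ht0⟩ := (h2.and h3).exists
      have := Data.nonneg_of_mem_body ht
      simp [hD.apply_dir] at this
      linarith
    refine ⟨h0, ?_⟩
    rw [mem_interior_iff_mem_nhds] at hz ⊢
    have hs : 0 < h (ofBody h κ c z) + κ := by
      rw [apply_ofBody hD.apply_dir h0]; positivity
    have h1 := (continuousAt_toBody (c := c) hs).eventually (by
      rw [toBody_ofBody hD.apply_dir h0]; exact hz)
    have h2 : ContinuousAt (fun x => h x + κ) (ofBody h κ c z) := by fun_prop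
    filter_upwards [h1, h2.eventually (lt_mem_nhds hs)] with x hx hx0
    rcases hx with hx | ⟨-, hx⟩
    · have := apply_toBody (κ := κ) hD.apply_dir x
      rw [hx, map_zero, eq_comm, inv_eq_zero] at this
      exact absurd this (by positivity)
    · rwa [ofBody_toBody hD.apply_dir hx0] at hx
  · rintro ⟨h0, hz⟩
    rw [mem_interior_iff_mem_nhds] at hz ⊢
    filter_upwards [(continuousAt_ofBody h0).eventually hz,
      h.continuous.continuousAt.eventually (lt_mem_nhds h0)] with w hw hw0
    exact Or.inr ⟨hw0, hw⟩

open Classical in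
/-- The homeomorphism from the convex body to the one-point compactification of `P`. -/
noncomputable def bodyMap (h : E →L[ℝ] ℝ) (κ : ℝ) (c z : E) : OnePoint E :=
  if 0 < h z then (ofBody h κ c z : E) else OnePoint.infty

theorem Data.continuousOn_bodyMap (hD : Data P h κ c) :
    ContinuousOn (bodyMap h κ c) (body P h κ c) := by
  rintro z (rfl | ⟨hz, -⟩)
  · have h0 : bodyMap h κ c 0 = OnePoint.infty := by simp [bodyMap]
    rw [ContinuousWithinAt, h0, OnePoint.hasBasis_nhds_infty.tendsto_right_iff]
    rintro s ⟨-, hs⟩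
    obtain ⟨B, hB⟩ := (hs.image h.continuous).bddAbove
    have hB' : ∀ x ∈ s, h x ≤ B := fun x hx => hB ⟨x, hx, rfl⟩
    have h1 : ContinuousAt (fun z => √(h z) * (|B| + |κ| + 1)) 0 :=
      ((Real.continuous_sqrt.comp h.continuous).mul continuous_const).continuousAt
    -- Near the origin `h (ofBody h κ c z) + κ = (√(h z))⁻¹` exceeds every bound, so the preimage
    -- leaves the compact set `s`.
    have h2 := h1.eventually (gt_mem_nhds (show √(h 0) * (|B| + |κ| + 1) < 1 by simp))
    filter_upwards [nhdsWithin_le_nhds h2] with z hz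
    by_cases h0 : 0 < h z
    · refine Or.inl ⟨ofBody h κ c z, fun hzs => ?_, by simp [bodyMap, h0]⟩
      have h3 := hB' _ hzs
      have h4 := apply_ofBody (κ := κ) hD.apply_dir h0
      have h5 : |B| + |κ| + 1 < (√(h z))⁻¹ := by
        rw [lt_inv_comm₀ (by positivity) (Real.sqrt_pos.2 h0), ← one_div,
          lt_div_iff₀ (by positivity)]
        exact hz
      have := le_abs_self B
      have := le_abs_self κ
      linarith
    · exact Or.inr (by simp [bodyMap, h0])
  · refine ContinuousAt.continuousWithinAt ?_
    have h1 : ContinuousAt (fun z => ((ofBody h κ c z : E) : OnePoint E)) z :=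
      OnePoint.continuous_coe.continuousAt.comp (continuousAt_ofBody hz)
    refine h1.congr ?_
    filter_upwards [h.continuous.continuousAt.eventually (lt_mem_nhds hz)] with w hw
    simp [bodyMap, hw]

theorem Data.injOn_bodyMap (hD : Data P h κ c) :
    Set.InjOn (bodyMap h κ c) (body P h κ c) := by
  rintro z (rfl | ⟨hz, -⟩) w (rfl | ⟨hw, -⟩) hzw
  · rfl
  · simp [bodyMap, hw] at hzw
  · simp [bodyMap, hz] at hzw
  · simp only [bodyMap, hz, hw, if_true, OnePoint.coe_eq_coe] at hzw
    rw [← toBody_ofBody (κ := κ) hD.apply_dir hz, hzw, toBody_ofBody hD.apply_dir hw]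

theorem Data.exists_map (hD : Data P h κ c) : ∃ m : E → OnePoint E,
    ContinuousOn m (Metric.closedBall 0 1) ∧ Set.InjOn m (Metric.closedBall 0 1) ∧
      m '' Metric.ball 0 1 = (↑) '' interior P ∧
      m '' Metric.sphere 0 1 = insert OnePoint.infty ((↑) '' (P \ interior P)) := by
  have hpos : ∀ x ∈ P, 0 < h x + κ := fun x hx => by have := hD.one_le x hx; linarith
  have hne : (interior (body P h κ c)).Nonempty := by
    obtain ⟨x, hx⟩ := hD.nonempty_interior
    rw [hD.interior_body]
    have hx0 := hpos x (interior_subset hx)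
    exact ⟨toBody h κ c x, by rw [apply_toBody hD.apply_dir]; positivity, by
      rwa [ofBody_toBody hD.apply_dir hx0]⟩
  obtain ⟨g, hg1, hg2, hg3⟩ := exists_homeomorph_image_interior_closure_frontier_eq_unitBall
    hD.convex_body hne hD.isBounded_body
  rw [hD.isClosed_body.closure_eq] at hg2
  rw [hD.isClosed_body.frontier_eq] at hg3
  have hmaps : Set.MapsTo g.symm (Metric.closedBall 0 1) (body P h κ c) := by
    rw [← hg2]
    rintro _ ⟨z, hz, rfl⟩
    simpa using hz
  refine ⟨bodyMap h κ c ∘ g.symm, hD.continuousOn_bodyMap.comp g.symm.continuous.continuousOn hmaps,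
    hD.injOn_bodyMap.comp g.symm.injective.injOn hmaps, ?_, ?_⟩
  · rw [← hg1, Set.image_image]
    simp only [Function.comp_apply, Homeomorph.symm_apply_apply]
    rw [hD.interior_body]
    ext w
    constructor
    · rintro ⟨z, ⟨hz, hzP⟩, rfl⟩
      exact ⟨_, hzP, by simp [bodyMap, hz]⟩
    · rintro ⟨x, hx, rfl⟩
      have hx0 := hpos x (interior_subset hx)
      have h1 : 0 < h (toBody h κ c x) := by rw [apply_toBody hD.apply_dir]; positivity
      have h2 := ofBody_toBody (κ := κ) hD.apply_dir hx0
      exact ⟨toBody h κ c x, ⟨h1, by rwa [h2]⟩, by simp [bodyMap, h1, h2]⟩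
  · rw [← hg3, Set.image_image]
    simp only [Function.comp_apply, Homeomorph.symm_apply_apply]
    rw [hD.interior_body]
    ext w
    constructor
    · rintro ⟨z, ⟨hz | ⟨hz, hzP⟩, hz'⟩, rfl⟩
      · left
        simp [bodyMap, hz]
      · exact Or.inr ⟨_, ⟨hzP, fun hi => hz' ⟨hz, hi⟩⟩, by simp [bodyMap, hz]⟩
    · rintro (rfl | ⟨x, hx, rfl⟩)
      · exact ⟨0, ⟨Or.inl rfl, by simp⟩, by simp [bodyMap]⟩
      · have hx0 := hpos x hx.1
        have h1 : 0 < h (toBody h κ c x) := by rw [apply_toBody hD.apply_dir]; positivity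
        have h2 := ofBody_toBody (κ := κ) hD.apply_dir hx0
        exact ⟨toBody h κ c x, ⟨toBody_mem_body hD.apply_dir hx0 hx.1, by simp [h2, hx.2]⟩,
          by simp [bodyMap, h1, h2]⟩

/-- A compact convex set with nonempty interior is a ball. -/
theorem exists_map_of_isBounded (hc : Convex ℝ P) (hcl : IsClosed P) (hne : (interior P).Nonempty)
    (hb : Bornology.IsBounded P) : ∃ m : E → OnePoint E,
    ContinuousOn m (Metric.closedBall 0 1) ∧ Set.InjOn m (Metric.closedBall 0 1) ∧
      m '' Metric.ball 0 1 = (↑) '' interior P ∧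
      m '' Metric.sphere 0 1 = (↑) '' (P \ interior P) := by
  obtain ⟨g, hg1, -, hg3⟩ := exists_homeomorph_image_interior_closure_frontier_eq_unitBall hc hne hb
  rw [hcl.frontier_eq] at hg3
  refine ⟨(↑) ∘ g.symm, (OnePoint.continuous_coe.comp g.symm.continuous).continuousOn,
    (OnePoint.coe_injective.comp g.symm.injective).injOn, ?_, ?_⟩
  · rw [← hg1, Set.image_image]; simp
  · rw [← hg3, Set.image_image]; simp

end Inversion

end ConvexCell

end

/-! ### Cell complexes from posets of cells, and transfer of shellings. -/

section

open Module Filter Topology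

namespace CellShelling

universe u

variable {X β : Type u} [TopologicalSpace X] [PartialOrder β]

/-- A continuous injection of a compact set into a Hausdorff space is a closed embedding. -/
theorem continuousOn_invFunOn {E : Type*} [TopologicalSpace E] [Nonempty E] [T2Space X] {K s : Set E}
    {f : E → X} (hK : IsCompact K) (hf : ContinuousOn f K) (hinj : Set.InjOn f K) (hs : s ⊆ K) :
    ContinuousOn (Function.invFunOn f s) (f '' s) := by
  have : CompactSpace K := isCompact_iff_compactSpace.1 hK
  have he : IsClosedEmbedding (K.domRestrict f) :=
    (continuousOn_iff_continuous_domRestrict.1 hf).isClosedEmbedding (Set.injOn_iff_injective.1 hinj)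
  rw [continuousOn_iff_continuous_domRestrict]
  have hg : ∀ x : f '' s, Function.invFunOn f s x ∈ s := fun x => Function.invFunOn_mem x.2
  let g : f '' s → K := fun x => ⟨Function.invFunOn f s x, hs (hg x)⟩
  have hgc : Continuous g := by
    rw [he.isEmbedding.continuous_iff]
    refine continuous_subtype_val.congr fun x => ?_
    exact (Function.invFunOn_eq x.2).symm
  exact continuous_subtype_val.comp hgc

/-- A decomposition of a space into cells indexed by a finite graded poset. -/
structure Decomposition (κ : X → β) (dim : β → ℕ) : Prop where
  finite : (Set.range κ).Finite
  lower : ∀ a b, a ≤ b → b ∈ Set.range κ → a ∈ Set.range κ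
  dim_lt : ∀ a b, a < b → dim a < dim b
  map : ∀ c ∈ Set.range κ, ∃ m : (Fin (dim c) → ℝ) → X,
    ContinuousOn m (Metric.closedBall 0 1) ∧ Set.InjOn m (Metric.closedBall 0 1) ∧
      m '' Metric.ball 0 1 = κ ⁻¹' {c} ∧ m '' Metric.sphere 0 1 = κ ⁻¹' Set.Iio c

variable {κ : X → β} {dim : β → ℕ}

theorem Decomposition.exists_map (h : Decomposition κ dim) (k : ℕ)
    (c : {c // c ∈ Set.range κ ∧ dim c = k}) : ∃ m : (Fin k → ℝ) → X,
    ContinuousOn m (Metric.closedBall 0 1) ∧ Set.InjOn m (Metric.closedBall 0 1) ∧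
      m '' Metric.ball 0 1 = κ ⁻¹' {c.1} ∧ m '' Metric.sphere 0 1 = κ ⁻¹' Set.Iio c.1 := by
  obtain ⟨c, hc, rfl⟩ := c
  exact h.map c hc

/-- The characteristic maps. -/
noncomputable def Decomposition.charMap (h : Decomposition κ dim) (k : ℕ)
    (c : {c // c ∈ Set.range κ ∧ dim c = k}) : (Fin k → ℝ) → X := (h.exists_map k c).choose

theorem Decomposition.charMap_closedBall (h : Decomposition κ dim) (k : ℕ)
    (c : {c // c ∈ Set.range κ ∧ dim c = k}) :
    h.charMap k c '' Metric.closedBall 0 1 = κ ⁻¹' Set.Iic c.1 := by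
  obtain ⟨-, -, h1, h2⟩ := (h.exists_map k c).choose_spec
  rw [← Metric.ball_union_sphere, Set.image_union]
  change (h.exists_map k c).choose '' _ ∪ (h.exists_map k c).choose '' _ = _
  rw [h1, h2, ← Set.preimage_union, Set.singleton_union, Set.Iio_insert]

/-- The CW structure given by a decomposition. -/
@[reducible]
noncomputable def Decomposition.cwComplex [T2Space X] (h : Decomposition κ dim) :
    CWComplex (Set.univ : Set X) where
  cell k := {c // c ∈ Set.range κ ∧ dim c = k}
  map k c := ((h.exists_map k c).choose_spec.2.1.mono
    Metric.ball_subset_closedBall).toPartialEquiv (h.charMap k c) (Metric.ball 0 1)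
  source_eq k c := rfl
  continuousOn k c := (h.exists_map k c).choose_spec.1
  continuousOn_symm k c := continuousOn_invFunOn (isCompact_closedBall 0 1)
    (h.exists_map k c).choose_spec.1 (h.exists_map k c).choose_spec.2.1
    Metric.ball_subset_closedBall
  pairwiseDisjoint' := by
    rintro ⟨k, c, hc, rfl⟩ - ⟨l, d, hd, rfl⟩ - hne
    change Disjoint (h.charMap _ _ '' _) (h.charMap _ _ '' _)
    rw [Decomposition.charMap, Decomposition.charMap,
      (h.exists_map _ ⟨c, hc, rfl⟩).choose_spec.2.2.1,
      (h.exists_map _ ⟨d, hd, rfl⟩).choose_spec.2.2.1]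
    refine Disjoint.preimage _ (Set.disjoint_singleton.2 ?_)
    rintro rfl
    exact hne rfl
  mapsTo' k c := by
    classical
    have hfin : ∀ m, Finite {c // c ∈ Set.range κ ∧ dim c = m} := fun m =>
      (h.finite.subset fun a ha => ha.1 :
        {c | c ∈ Set.range κ ∧ dim c = m}.Finite).to_subtype
    have := fun m => Fintype.ofFinite {c // c ∈ Set.range κ ∧ dim c = m}
    refine ⟨fun m => Finset.univ, fun z hz => ?_⟩
    have h1 : h.charMap k c z ∈ κ ⁻¹' Set.Iio c.1 := by
      rw [← (h.exists_map k c).choose_spec.2.2.2]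
      exact ⟨z, hz, rfl⟩
    have h2 := h.dim_lt _ _ h1
    rw [c.2.2] at h2
    simp only [Set.mem_iUnion]
    refine ⟨_, h2, ⟨_, ⟨_, rfl⟩, rfl⟩, Finset.mem_univ _, ?_⟩
    change _ ∈ h.charMap _ _ '' _
    rw [h.charMap_closedBall]
    exact le_rfl
  -- `A` is the union of its finitely many intersections with closed cells.
  closed' A _ hA := by
    have hfin : Finite (Set.range κ) := h.finite.to_subtype
    have hAeq : A = ⋃ c : Set.range κ, A ∩ κ ⁻¹' Set.Iic c.1 := by
      ext x
      simp only [Set.mem_iUnion, Set.mem_inter_iff]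
      exact ⟨fun hx => ⟨⟨κ x, x, rfl⟩, hx, le_rfl⟩, fun ⟨_, hx, _⟩ => hx⟩
    rw [hAeq]
    refine isClosed_iUnion_of_finite fun c => ?_
    have h1 := hA (dim c.1) ⟨c.1, c.2, rfl⟩
    rw [← h.charMap_closedBall _ ⟨c.1, c.2, rfl⟩]
    exact h1
  union' := by
    refine Set.eq_univ_of_forall fun x => ?_
    simp only [Set.mem_iUnion]
    refine ⟨dim (κ x), ⟨κ x, ⟨x, rfl⟩, rfl⟩, ?_⟩
    change _ ∈ h.charMap _ _ '' _
    rw [h.charMap_closedBall]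
    exact le_rfl

open ConeShelling in
/-- Shellings of the face poset give shellings of the cell complex. -/
theorem isShelling_of_orderShelling [CWComplex (Set.univ : Set X)]
    (e : Cell (Set.univ : Set X) → β) (he : Function.Injective e)
    (hlow : ∀ a b, a ≤ b → b ∈ Set.range e → a ∈ Set.range e)
    (hle : ∀ σ τ : Cell (Set.univ : Set X), σ.closed ⊆ τ.closed ↔ e σ ≤ e τ)
    (hbd : ∀ σ τ : Cell (Set.univ : Set X), τ ∈ σ.boundary ↔ e τ < e σ)
    (hdim : ∀ σ : Cell (Set.univ : Set X), σ.1 = dim (e σ))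
    {S : Set β} {l : List β} (h : OrderShelling dim S l) (hS : S ⊆ Set.range e) :
    ∀ l' : List (Cell (Set.univ : Set X)), l = l'.map e → IsShelling (e ⁻¹' S) l' := by
  have hmax : ∀ (A : Set β), A ⊆ Set.range e → ∀ σ, σ ∈ maximalCells (e ⁻¹' A) ↔
      Maximal (· ∈ A) (e σ) := by
    intro A hA σ
    constructor
    · rintro ⟨h1, h2⟩
      refine ⟨h1, fun b hb hσb => ?_⟩
      obtain ⟨τ, rfl⟩ := hA hb
      rw [h2 τ hb ((hle σ τ).2 hσb)]
    · intro h
      refine ⟨h.prop, fun τ hτ hστ => he ?_⟩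
      have h1 := (hle σ τ).1 hστ
      exact le_antisymm (h.le_of_ge hτ h1) h1
  have hbd' : ∀ σ : Cell (Set.univ : Set X), σ.boundary = e ⁻¹' Set.Iio (e σ) := fun σ =>
    Set.ext fun τ => hbd σ τ
  have hord : ∀ {A : Set β} {l : List β}, A ⊆ Set.range e → l.Nodup →
      (∀ σ, σ ∈ l ↔ Maximal (· ∈ A) σ) → ∀ l' : List (Cell (Set.univ : Set X)), l = l'.map e →
      IsOrderingOfMaximalCells (e ⁻¹' A) l' := by
    rintro A l hA hd hl l' rfl
    refine ⟨List.Nodup.of_map _ hd, fun σ => ?_⟩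
    rw [hmax A hA, ← hl, List.mem_map_of_injective he]
  have hatt : ∀ (l₁ : List (Cell (Set.univ : Set X))) σ,
      attachingComplex l₁ σ = e ⁻¹' attaching (l₁.map e) (e σ) := by
    intro l₁ σ
    ext τ
    simp [attachingComplex, attaching, hbd]
  have hlowI : ∀ σ, Set.Iio (e σ) ⊆ Set.range e := fun σ a ha => hlow a _ (le_of_lt ha) ⟨σ, rfl⟩
  have hlift : ∀ l : List β, (∀ a ∈ l, a ∈ Set.range e) →
      ∃ l' : List (Cell (Set.univ : Set X)), l = l'.map e := by
    intro l hl
    obtain ⟨l', hl'⟩ := (Set.range_list_map e).ge hl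
    exact ⟨l', hl'.symm⟩
  induction h with
  | zero S l hd hl h0 =>
    intro l' hl'
    refine .zero _ _ (hord hS hd hl l' hl') fun σ hσ => ?_
    rw [hdim]
    exact h0 _ hσ
  | step S l hd hl L hL pure initial ih =>
    rintro l' rfl
    have hL' : ∀ σ : Cell (Set.univ : Set X), σ ∈ l' → ∃ lσ : List (Cell (Set.univ : Set X)),
        L (e σ) = lσ.map e := by
      intro σ hσ
      refine hlift _ fun a ha => hlowI σ ?_
      have := hL (e σ) (List.mem_map_of_mem hσ)
      cases this with
      | zero _ _ _ hl _ => exact ((hl a).1 ha).prop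
      | step _ _ _ hl _ _ _ _ => exact ((hl a).1 ha).prop
    choose! L' hL' using hL'
    refine .step _ _ (hord hS hd hl l' rfl) L' ?_ ?_ ?_
    · intro σ hσ
      rw [hbd']
      exact ih (e σ) (List.mem_map_of_mem hσ) (hlowI σ) _ (hL' σ hσ)
    · rintro l₁ σ l₂ rfl hne
      obtain ⟨hne', hp⟩ := pure (l₁.map e) (e σ) (l₂.map e) (by simp) (by simpa using hne)
      rw [hatt]
      have hsub : attaching (l₁.map e) (e σ) ⊆ Set.range e := fun a ha => hlowI σ ha.1
      refine ⟨fun τ hτ => ?_, fun h0 => ?_⟩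
      · have := hp _ ((hmax _ hsub τ).1 hτ)
        rw [hdim τ, hdim σ, ← this]
        simp
      · obtain ⟨a, ha⟩ := hne'
        obtain ⟨τ, rfl⟩ := hsub ha
        exact absurd (show τ ∈ (∅ : Set _) from h0 ▸ ha) (Set.notMem_empty τ)
    · rintro l₁ σ l₂ rfl hne
      obtain ⟨k, hk⟩ := initial (l₁.map e) (e σ) (l₂.map e) (by simp) (by simpa using hne)
      have hsub : attaching (l₁.map e) (e σ) ⊆ Set.range e := fun a ha => hlowI σ ha.1
      refine ⟨k, fun τ => ?_⟩
      rw [hatt, hmax _ hsub, ← hk, hL' σ (by simp), ← List.map_take,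
        List.mem_map_of_injective he]

open ConeShelling in
-- Open cells, closed cells and boundaries are the preimages of `{c}`, `Iic c` and `Iio c`. As every
-- index is attained, inclusions between them amount to the order of the indices.
theorem Decomposition.exists_shellable [T2Space X] (h : Decomposition κ dim)
    (hsh : ∃ l, OrderShelling dim (Set.range κ) l) :
    ∃ _ : CWComplex (Set.univ : Set X),
      RelCWComplex.Finite (Set.univ : Set X) ∧ IsRegular (Set.univ : Set X) ∧
      Set.range (Cell.closed (C := (Set.univ : Set X))) =
        (fun c => κ ⁻¹' Set.Iic c) '' Set.range κ ∧
      IsShellable (Set.univ : Set X) := by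
  let := h.cwComplex
  let e : Cell (Set.univ : Set X) → β := fun σ => σ.2.1
  have hecl : ∀ σ : Cell (Set.univ : Set X), σ.closed = κ ⁻¹' Set.Iic (e σ) := fun σ =>
    h.charMap_closedBall σ.1 σ.2
  have hefr : ∀ σ : Cell (Set.univ : Set X), RelCWComplex.cellFrontier σ.1 σ.2 =
      κ ⁻¹' Set.Iio (e σ) := fun σ => (h.exists_map σ.1 σ.2).choose_spec.2.2.2
  have he : Function.Injective e := by
    rintro ⟨k, c, hc, rfl⟩ ⟨l, d, hd, rfl⟩ hcd
    obtain rfl : c = d := hcd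
    rfl
  have hmem : ∀ σ, e σ ∈ Set.range κ := fun σ => σ.2.2.1
  have hrange : Set.range e = Set.range κ := by
    refine Set.Subset.antisymm (Set.range_subset_iff.2 hmem) fun c hc => ?_
    exact ⟨⟨dim c, c, hc, rfl⟩, rfl⟩
  have hdim : ∀ σ : Cell (Set.univ : Set X), σ.1 = dim (e σ) := fun σ => σ.2.2.2.symm
  refine ⟨inferInstance, ?_, ?_, ?_, ?_⟩
  · rw [RelCWComplex.finite_iff_finite_cells]
    have := h.finite.to_subtype
    exact Finite.of_injective (fun σ : Cell (Set.univ : Set X) =>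
      (⟨e σ, hmem σ⟩ : Set.range κ)) fun σ τ hστ => he (congrArg Subtype.val hστ)
  · exact fun k c => (h.exists_map k c).choose_spec.2.1
  · rw [← hrange, ← Set.range_comp]
    congr 1
    ext1 σ
    exact hecl σ
  · obtain ⟨l, hl⟩ := hsh
    have hll : ∀ a ∈ l, a ∈ Set.range e := by
      intro a ha
      rw [hrange]
      cases hl with
      | zero _ _ _ hl _ => exact ((hl a).1 ha).prop
      | step _ _ _ hl _ _ _ _ => exact ((hl a).1 ha).prop
    obtain ⟨l', hl'⟩ := (Set.range_list_map e).ge hll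
    refine ⟨l', ?_⟩
    have huniv : (Set.univ : Set (Cell (Set.univ : Set X))) = e ⁻¹' Set.range κ := by
      rw [← hrange, Set.preimage_range]
    rw [huniv]
    refine isShelling_of_orderShelling e he ?_ ?_ ?_ hdim hl hrange.ge l' hl'.symm
    · rw [hrange]; exact h.lower
    · intro σ τ
      rw [hecl, hecl]
      refine ⟨fun hs => ?_, fun hs => Set.preimage_mono (Set.Iic_subset_Iic.2 hs)⟩
      obtain ⟨x, hx⟩ := hmem σ
      have := hs (show x ∈ κ ⁻¹' Set.Iic (e σ) from hx.le)
      rwa [Set.mem_preimage, hx] at this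
    · intro σ τ
      change Cell.closed τ ⊆ RelCWComplex.cellFrontier σ.1 σ.2 ↔ _
      rw [hecl, hefr]
      refine ⟨fun hs => ?_, fun hs x hx => lt_of_le_of_lt hx hs⟩
      obtain ⟨x, hx⟩ := hmem τ
      have := hs (show x ∈ κ ⁻¹' Set.Iic (e τ) from hx.le)
      rwa [Set.mem_preimage, hx] at this

end CellShelling

end

/-! ### Construction of a generic height functional. -/

section

open Module Filter Topology

namespace ConeShelling

variable {V J : Type*} [AddCommGroup V] [Module ℝ V]

/-- The face of the cone `y ≥ 0` supported on `S` has nonzero points in the hyperplane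
`y j₀ = 0`. -/
def HasRecession (y : J → V →ₗ[ℝ] ℝ) (j₀ : J) (S : Set J) : Prop :=
  ∃ z, z ≠ 0 ∧ (∀ i, 0 ≤ y i z) ∧ (∀ i ∉ S, y i z = 0) ∧ y j₀ z = 0

variable [Fintype J] {y : J → V →ₗ[ℝ] ℝ} {j₀ : J}

theorem sum_pos_of_ne_zero (hy : ∀ z, (∀ i, y i z = 0) → z = 0) {z : V} (hz : ∀ i, 0 ≤ y i z)
    (hz0 : z ≠ 0) {w : J → ℝ} (hw : ∀ i, 0 < w i) : 0 < ∑ i, w i * y i z := by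
  refine Finset.sum_pos' (fun i _ => mul_nonneg (hw i).le (hz i)) ?_
  by_contra! h
  refine hz0 (hy z fun i => le_antisymm ?_ (hz i))
  have := h i (Finset.mem_univ i)
  by_contra! h'
  exact absurd this (not_le.2 (mul_pos (hw i) h'))

variable [FiniteDimensional ℝ V]

/-- Normalized to `∑ i, y i z = 1`, the face becomes a compact slice of the simplex on which `y j₀`
does not vanish. The constant is the inverse of its minimum there. -/
theorem exists_sum_le_of_not_hasRecession {S : Set J}
    (h : ¬ HasRecession y j₀ S) :
    ∃ B : ℝ, ∀ z, (∀ i, 0 ≤ y i z) → (∀ i ∉ S, y i z = 0) → ∑ i, y i z ≤ B * y j₀ z := by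
  classical
  let Φ : V →ₗ[ℝ] J → ℝ := LinearMap.pi y
  set K : Set (J → ℝ) := stdSimplex ℝ J ∩ ((LinearMap.range Φ : Set (J → ℝ)) ∩
    ⋂ i ∈ Sᶜ, {v | v i = 0})
  have hK : IsCompact K := (isCompact_stdSimplex ℝ J).inter_right
    ((LinearMap.range Φ).closed_of_finiteDimensional.inter
      (isClosed_biInter fun i _ => isClosed_eq (continuous_apply i) continuous_const))
  have hmem : ∀ z, (∀ i, 0 ≤ y i z) → (∀ i ∉ S, y i z = 0) → 0 < ∑ i, y i z →
      Φ ((∑ i, y i z)⁻¹ • z) ∈ K := by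
    intro z hz hz' hpos
    refine ⟨⟨fun i => ?_, ?_⟩, ⟨_, rfl⟩, ?_⟩
    · simpa [Φ] using mul_nonneg (inv_nonneg.2 hpos.le) (hz i)
    · simp [Φ, ← Finset.mul_sum, inv_mul_cancel₀ hpos.ne']
    · simp only [Set.mem_iInter, Set.mem_ofPred_eq]
      intro i hi
      simp [Φ, hz' i hi]
  rcases K.eq_empty_or_nonempty with hK0 | hKn
  · refine ⟨0, fun z hz hz' => ?_⟩
    by_contra! hpos
    rw [zero_mul] at hpos
    exact Set.notMem_empty _ (hK0 ▸ hmem z hz hz' hpos)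
  obtain ⟨v, hvK, hv⟩ := hK.exists_isMinOn hKn (continuous_apply j₀).continuousOn
  have hvpos : 0 < v j₀ := by
    refine lt_of_le_of_ne (hvK.1.1 j₀) fun h0 => h ?_
    obtain ⟨⟨h1, h2⟩, ⟨z, rfl⟩, h3⟩ := hvK
    simp only [Set.mem_iInter, Set.mem_ofPred_eq] at h3
    refine ⟨z, ?_, h1, h3, h0.symm⟩
    rintro rfl
    simp at h2
  refine ⟨(v j₀)⁻¹, fun z hz hz' => ?_⟩
  rcases (Finset.sum_nonneg fun i _ => hz i).eq_or_lt with h0 | hpos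
  · rw [← h0]
    exact mul_nonneg (inv_nonneg.2 hvpos.le) (hz j₀)
  · have : v j₀ ≤ (∑ i, y i z)⁻¹ * y j₀ z := by simpa [Φ] using hv (hmem z hz hz' hpos)
    rw [inv_mul_eq_div, le_div_iff₀ hvpos]
    rw [inv_mul_eq_div, le_div_iff₀ hpos] at this
    linarith

/-- Fix for each triple `(S, i, j)` a nonzero `v` in the common kernel. With distinct powers of `ε`
as weights, the condition says that `ε` is not a root of a polynomial whose nonconstant coefficients
are the `- y k v`, not all zero. Finitely many triples exclude finitely many `ε`. -/
theorem exists_weights (hy : ∀ z, (∀ i, y i z = 0) → z = 0) (T : ℝ) :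
    ∃ w : J → ℝ, (∀ i, 0 < w i ∧ w i ≤ 1) ∧ ∀ S : Set J, 3 ≤ finrank ℝ (flat y S) → ∀ i j,
      ∃ v ∈ flat y S, y i v = 0 ∧ y j v = 0 ∧ T * y j₀ v - ∑ k, w k * y k v ≠ 0 := by
  classical
  have hv : ∀ a : Set J × J × J, 3 ≤ finrank ℝ (flat y a.1) →
      ∃ v ∈ flat y a.1, y a.2.1 v = 0 ∧ y a.2.2 v = 0 ∧ v ≠ 0 := by
    rintro ⟨S, i, j⟩ hS
    have h1 := finrank_le_inf_ker (flat y S) (y i)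
    have h2 := finrank_le_inf_ker (flat y S ⊓ LinearMap.ker (y i)) (y j)
    have hpos : 0 < finrank ℝ
        (flat y S ⊓ LinearMap.ker (y i) ⊓ LinearMap.ker (y j) : Submodule ℝ V) := by
      simp only at hS; omega
    obtain ⟨⟨v, ⟨hvS, hi⟩, hj⟩, hv⟩ := Module.finrank_pos_iff_exists_ne_zero.1 hpos
    exact ⟨v, hvS, hi, hj, fun h => hv (Subtype.ext h)⟩
  choose! v hvS hvi hvj hv0 using hv
  let idx := Fintype.equivFin J
  let Q : Set J × J × J → Polynomial ℝ := fun a =>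
    Polynomial.C (T * y j₀ (v a)) -
      ∑ k, Polynomial.C (y k (v a)) * Polynomial.X ^ ((idx k : ℕ) + 1)
  have hQ : ∀ a, 3 ≤ finrank ℝ (flat y a.1) → Q a ≠ 0 := by
    intro a ha h0
    refine hv0 a ha (hy _ fun i => ?_)
    have := congrArg (fun p => Polynomial.coeff p ((idx i : ℕ) + 1)) h0
    simp only [Q, Polynomial.coeff_sub, Polynomial.coeff_C_succ, Polynomial.finsetSum_coeff,
      Polynomial.coeff_C_mul, Polynomial.coeff_X_pow, Polynomial.coeff_zero, zero_sub,
      neg_eq_zero] at this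
    rw [Finset.sum_eq_single i] at this
    · simpa using this
    · intro k _ hk
      rw [if_neg, mul_zero]
      intro h
      exact hk (idx.injective (Fin.ext (by omega)))
    · simp
  have hfin : (⋃ a ∈ {a : Set J × J × J | 3 ≤ finrank ℝ (flat y a.1)},
      {x | (Q a).IsRoot x}).Finite :=
    (Set.toFinite _).biUnion fun a ha => Polynomial.finite_setOfPred_isRoot (hQ a ha)
  obtain ⟨ε, hε, hεQ⟩ := (Set.Ioo_infinite (show (0 : ℝ) < 1 by norm_num)).exists_notMem_finite hfin
  refine ⟨fun k => ε ^ ((idx k : ℕ) + 1), fun k => ⟨pow_pos hε.1 _, pow_le_one₀ hε.1.le hε.2.le⟩,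
    fun S hS i j => ⟨v (S, i, j), hvS (S, i, j) hS, hvi (S, i, j) hS, hvj (S, i, j) hS, fun h0 => ?_⟩⟩
  refine hεQ (Set.mem_biUnion (show (S, i, j) ∈ {a : Set J × J × J | _} from hS) ?_)
  simp only [Q, Set.mem_ofPred_eq, Polynomial.IsRoot, Polynomial.eval_sub, Polynomial.eval_C,
    Polynomial.eval_finsetSum, Polynomial.eval_mul, Polynomial.eval_pow, Polynomial.eval_X]
  rw [← h0]
  congr 1
  exact Finset.sum_congr rfl fun k _ => mul_comm _ _

/-- A hyperplane in general position cutting off the recession cones. -/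
theorem exists_height (hy : ∀ z, (∀ i, y i z = 0) → z = 0) (j₀ : J) :
    ∃ η : V →ₗ[ℝ] ℝ, IsTruncated y η ∧
      (∀ z, (∀ i, 0 ≤ y i z) → 0 < y j₀ z → IsFace y η {i | y i z ≠ 0}) ∧
      (∀ S, IsUnb y η S ↔ HasRecession y j₀ S) ∧
      ∀ z, (∀ i, 0 ≤ y i z) → 0 < η z → 0 < y j₀ z := by
  classical
  have hT₁ : ∀ S : Set J, ∀ᶠ T : ℝ in atTop, ¬ HasRecession y j₀ S → ∀ z, (∀ i, 0 ≤ y i z) →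
      (∀ i ∉ S, y i z = 0) → z ≠ 0 → ∑ i, y i z < T * y j₀ z := by
    intro S
    by_cases hS : HasRecession y j₀ S
    · exact Eventually.of_forall fun _ h => absurd hS h
    obtain ⟨B, hB⟩ := exists_sum_le_of_not_hasRecession hS
    filter_upwards [eventually_gt_atTop B] with T hT _ z hz hz' hz0
    have h1 := hB z hz hz'
    have h2 := sum_pos_of_ne_zero hy hz hz0 (w := fun _ => 1) fun _ => one_pos
    simp only [one_mul] at h2
    have h3 : 0 < y j₀ z := by
      refine lt_of_le_of_ne (hz j₀) fun h => ?_
      rw [← h, mul_zero] at h1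
      linarith
    nlinarith
  have hT₂ : ∀ S : Set J, ∀ᶠ T : ℝ in atTop,
      (∃ z, (∀ i ∈ S, 0 < y i z) ∧ (∀ i ∉ S, y i z = 0) ∧ 0 < y j₀ z) →
      ∃ z, (∀ i ∈ S, 0 < y i z) ∧ (∀ i ∉ S, y i z = 0) ∧ ∑ i, y i z < T * y j₀ z := by
    intro S
    by_cases hS : ∃ z, (∀ i ∈ S, 0 < y i z) ∧ (∀ i ∉ S, y i z = 0) ∧ 0 < y j₀ z
    swap
    · exact Eventually.of_forall fun _ h => absurd h hS
    obtain ⟨z, h1, h2, h3⟩ := hS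
    filter_upwards [eventually_gt_atTop ((∑ i, y i z) / y j₀ z)] with T hT _
    exact ⟨z, h1, h2, (div_lt_iff₀ h3).1 hT⟩
  obtain ⟨T, h₁, h₂⟩ := ((eventually_all.2 hT₁).and (eventually_all.2 hT₂)).exists
  obtain ⟨w, hw, hgen⟩ := exists_weights (j₀ := j₀) hy T
  -- Nonzero recession directions get negative height. Since the weights are at most `1`, a large
  -- `T` makes faces without recession positive and gives every face meeting `y j₀ > 0` an interior
  -- point of positive height.
  let η : V →ₗ[ℝ] ℝ := T • y j₀ - ∑ i, w i • y i
  have hη : ∀ z, η z = T * y j₀ z - ∑ i, w i * y i z := fun z => by simp [η]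
  have hwle : ∀ z, (∀ i, 0 ≤ y i z) → ∑ i, w i * y i z ≤ ∑ i, y i z := fun z hz =>
    Finset.sum_le_sum fun i _ => mul_le_of_le_one_left (hz i) (hw i).2
  have hwpos : ∀ z, (∀ i, 0 ≤ y i z) → z ≠ 0 → 0 < ∑ i, w i * y i z := fun z hz hz0 =>
    sum_pos_of_ne_zero hy hz hz0 fun i => (hw i).1
  have hface : ∀ z, (∀ i, 0 ≤ y i z) → 0 < y j₀ z → IsFace y η {i | y i z ≠ 0} := by
    intro z hz hz0
    obtain ⟨x, hx, hx', hlt⟩ := h₂ {i | y i z ≠ 0}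
      ⟨z, fun i hi => lt_of_le_of_ne (hz i) (Ne.symm hi), fun i hi => by simpa using hi, hz0⟩
    refine ⟨x, hx, hx', ?_⟩
    have := hwle x fun i => by
      by_cases hi : i ∈ {i | y i z ≠ 0}
      exacts [(hx i hi).le, (hx' i hi).ge]
    rw [hη]
    linarith
  have hrec : ∀ S z, (∀ i, 0 ≤ y i z) → (∀ i ∉ S, y i z = 0) → z ≠ 0 → η z ≤ 0 →
      HasRecession y j₀ S := by
    intro S z hz hz' hz0 hηz
    by_contra h
    have := h₁ S h z hz hz' hz0
    have := hwle z hz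
    rw [hη] at hηz
    linarith
  have hunb : ∀ S, IsUnb y η S ↔ HasRecession y j₀ S := by
    intro S
    constructor
    · rintro ⟨z, hz, hz', hηz⟩
      exact hrec S z hz hz' (by rintro rfl; simp at hηz) hηz.le
    · rintro ⟨z, hz0, hz, hz', hj⟩
      refine ⟨z, hz, hz', ?_⟩
      rw [hη, hj]
      linarith [hwpos z hz hz0]
  refine ⟨η, ⟨hy, fun z hz hz0 hηz => hface z hz ?_, fun z hz hz0 hηz => (hunb _).2 ?_, ?_⟩, hface,
    hunb, fun z hz hηz => ?_⟩
  · refine lt_of_le_of_ne (hz j₀) fun h => ?_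
    rw [hη, ← h] at hηz
    linarith [hwpos z hz hz0]
  · exact hrec _ z hz (fun i hi => by simpa using hi) hz0 hηz.le
  · intro S _ hd i j
    obtain ⟨v, hv, hi, hj, h⟩ := hgen S hd i j
    exact ⟨v, hv, hi, hj, by rwa [hη]⟩
  · refine lt_of_le_of_ne (hz j₀) fun h => ?_
    rw [hη, ← h] at hηz
    have := Finset.sum_nonneg fun i (_ : i ∈ Finset.univ) => mul_nonneg (hw i).1.le (hz i)
    linarith

end ConeShelling

end

/-! ### The homogenized dome of a minimum of affine functions, and charts of its faces. -/

section

open Module Filter Topology ConeShelling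

namespace AffineMin

universe u

variable {T : Type u} [AddCommGroup T] [Module ℝ T] {I : Type u}

/-- The minimum of the affine functions `g a + b a`. -/
noncomputable def minVal (g : I → T →ₗ[ℝ] ℝ) (b : I → ℝ) (x : T) : ℝ := ⨅ a, (g a x + b a)

/-- The inequalities of the homogenization of the dome `s ≤ min_a (g a x + b a)`. -/
def slack (g : I → T →ₗ[ℝ] ℝ) (b : I → ℝ) : Option I → (T × ℝ × ℝ) →ₗ[ℝ] ℝ
  | none => LinearMap.snd ℝ ℝ ℝ ∘ₗ LinearMap.snd ℝ T (ℝ × ℝ)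
  | some a => g a ∘ₗ LinearMap.fst ℝ T (ℝ × ℝ) +
      b a • (LinearMap.snd ℝ ℝ ℝ ∘ₗ LinearMap.snd ℝ T (ℝ × ℝ)) -
      LinearMap.fst ℝ ℝ ℝ ∘ₗ LinearMap.snd ℝ T (ℝ × ℝ)

/-- The point of the boundary of the dome above `x`. -/
noncomputable def lift (g : I → T →ₗ[ℝ] ℝ) (b : I → ℝ) (x : T) : T × ℝ × ℝ := (x, minVal g b x, 1)

/-- The inequalities which are strict at the point of the boundary of the dome above `x`. -/
def support (g : I → T →ₗ[ℝ] ℝ) (b : I → ℝ) (x : T) : Set (Option I) :=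
  {i | slack g b i (lift g b x) ≠ 0}

variable {g : I → T →ₗ[ℝ] ℝ} {b : I → ℝ}

@[simp] theorem slack_none (z : T × ℝ × ℝ) : slack g b none z = z.2.2 := rfl

@[simp] theorem slack_some (a : I) (z : T × ℝ × ℝ) :
    slack g b (some a) z = g a z.1 + b a * z.2.2 - z.2.1 := rfl

theorem slack_pointed [Nonempty I] (hg : ∀ v, (∀ a a', g a v = g a' v) → v = 0) (z : T × ℝ × ℝ)
    (hz : ∀ i, slack g b i z = 0) : z = 0 := by
  obtain ⟨x, s, e⟩ := z
  have he : e = 0 := hz none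
  subst he
  have hs : ∀ a, g a x = s := fun a => by
    have := hz (some a)
    simp at this
    linarith
  have hx : x = 0 := hg x fun a a' => by rw [hs, hs]
  subst hx
  have := hs (Classical.arbitrary I)
  simp at this
  simp [← this]

theorem none_mem_support (x : T) : none ∈ support g b x := by
  simp [support, lift]

theorem slack_lift_eq_zero {x : T} {i : Option I} (hi : i ∉ support g b x) :
    slack g b i (lift g b x) = 0 := by
  simpa [support] using hi

section Finite

variable [Finite I]

theorem minVal_le (x : T) (a : I) : minVal g b x ≤ g a x + b a :=
  ciInf_le (Set.finite_range _).bddBelow a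

theorem slack_lift_nonneg (x : T) (i : Option I) : 0 ≤ slack g b i (lift g b x) := by
  cases i with
  | none => simp [lift]
  | some a => simpa [lift] using minVal_le x a

variable [Nonempty I]

theorem exists_minVal_eq (x : T) : ∃ a, minVal g b x = g a x + b a := by
  obtain ⟨a, ha⟩ := exists_eq_ciInf_of_finite (f := fun a => g a x + b a)
  exact ⟨a, ha.symm⟩

theorem exists_notMem_support (x : T) : ∃ a, some a ∉ support g b x := by
  obtain ⟨a, ha⟩ := exists_minVal_eq (g := g) (b := b) x
  exact ⟨a, by simp [support, lift, ha]⟩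

theorem lift_fst {z : T × ℝ × ℝ} (he : z.2.2 = 1) (hz : ∀ i, 0 ≤ slack g b i z)
    (ha : ∃ a, slack g b (some a) z = 0) : lift g b z.1 = z := by
  obtain ⟨x, s, e⟩ := z
  simp only at he
  subst he
  obtain ⟨a, ha⟩ := ha
  obtain ⟨a', ha'⟩ := exists_minVal_eq (g := g) (b := b) x
  have h1 := minVal_le (g := g) (b := b) x a
  have h2 := hz (some a')
  simp only [slack_some] at ha h2
  have : minVal g b x = s := by linarith
  simp [lift, this]

end Finite

section Chart

/-- The polyhedron cut out by the inequalities `0 ≤ y i` on an affine subspace. -/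
def chart {V J : Type*} [AddCommGroup V] [Module ℝ V] (y : J → V →ₗ[ℝ] ℝ) (q : V) {k : ℕ}
    (β : (Fin k → ℝ) →ₗ[ℝ] V) : Set (Fin k → ℝ) :=
  {u | ∀ i, 0 ≤ y i (q + β u)}

variable {V J : Type*} [AddCommGroup V] [Module ℝ V] {y : J → V →ₗ[ℝ] ℝ} {q : V} {k : ℕ}
  {β : (Fin k → ℝ) →ₗ[ℝ] V} {S : Set J}

theorem continuous_chart (i : J) : Continuous fun u => y i (q + β u) := by
  simp only [map_add]
  exact continuous_const.add (y i ∘ₗ β).continuous_of_finiteDimensional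

theorem isClosed_chart : IsClosed (chart y q β) := by
  simp only [chart, Set.ofPred_forall]
  exact isClosed_iInter fun i => isClosed_le continuous_const (continuous_chart i)

theorem convex_chart : Convex ℝ (chart y q β) := by
  intro u hu v hv s t hs ht hst i
  have h : q + β (s • u + t • v) = s • (q + β u) + t • (q + β v) := by
    have : q = (s + t) • q := by rw [hst, one_smul]
    simp only [map_add, map_smul, smul_add]
    nth_rw 1 [this]
    rw [add_smul]; abel
  rw [h]
  simp only [map_add (y i) (s • _), map_smul (y i), smul_eq_mul]
  exact add_nonneg (mul_nonneg hs (hu i)) (mul_nonneg ht (hv i))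

variable [Fintype J]

/-- All `y i` with `i ∈ S` are positive at `u = 0`. If one of them vanished at an interior point
`u`, it would be negative at `(1 + t) • u`. -/
theorem interior_chart (hq : ∀ i ∈ S, 0 < y i q) (hq' : q ∈ flat y S) (hβ : ∀ u, β u ∈ flat y S) :
    interior (chart y q β) = {u | ∀ i ∈ S, 0 < y i (q + β u)} := by
  have hz : ∀ u, ∀ i ∉ S, y i (q + β u) = 0 := fun u => mem_flat.1 (add_mem hq' (hβ u))
  apply Set.Subset.antisymm
  · intro u hu i hi
    refine lt_of_le_of_ne (interior_subset hu i) fun h0 => ?_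
    rw [mem_interior_iff_mem_nhds] at hu
    have hc : ContinuousAt (fun t : ℝ => (1 + t) • u) 0 := by fun_prop
    have h1 : ∀ᶠ t : ℝ in 𝓝 0, (1 + t) • u ∈ chart y q β := hc.preimage_mem_nhds (by
      have e : (1 + (0 : ℝ)) • u = u := by simp
      rw [e]; exact hu)
    have h2 : ∀ᶠ t : ℝ in 𝓝[>] 0, (1 + t) • u ∈ chart y q β := nhdsWithin_le_nhds h1
    have h3 : ∀ᶠ t : ℝ in 𝓝[>] 0, 0 < t := self_mem_nhdsWithin
    obtain ⟨t, ht, ht0⟩ := (h2.and h3).exists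
    have h4 := ht i
    have h5 := hq i hi
    simp only [map_add, map_smul, smul_eq_mul] at h4 h0
    nlinarith
  · refine interior_maximal (fun u hu i => ?_) ?_
    · by_cases hi : i ∈ S
      exacts [(hu i hi).le, (hz u i hi).ge]
    · simp only [Set.ofPred_forall]
      exact (Set.toFinite S).isOpen_biInter fun i _ => isOpen_lt continuous_const (continuous_chart i)

/-- Since the cone is pointed, `u ↦ (y i (β u))ᵢ` is an injective linear map and hence
antilipschitz. -/
theorem exists_norm_le_chart (hy : ∀ z, (∀ i, y i z = 0) → z = 0) (hβ : Function.Injective β) :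
    ∃ K : ℝ, 0 ≤ K ∧ ∀ u ∈ chart y q β, ‖u‖ ≤ K * (∑ i, y i (q + β u) + ∑ i, |y i q|) := by
  let Φ : (Fin k → ℝ) →ₗ[ℝ] J → ℝ := LinearMap.pi fun i => y i ∘ₗ β
  obtain ⟨K, -, hK⟩ := Φ.exists_antilipschitzWith (by
    rw [LinearMap.ker_eq_bot, injective_iff_map_eq_zero]
    intro u hu
    exact (map_eq_zero_iff β hβ).1 (hy _ fun i => congrFun hu i))
  refine ⟨K, K.2, fun u hu => ?_⟩
  have h1 := hK.le_mul_dist u 0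
  rw [map_zero, dist_zero_right, dist_zero_right] at h1
  refine h1.trans (mul_le_mul_of_nonneg_left ?_ K.2)
  rw [← Finset.sum_add_distrib]
  have hnn : ∀ i, 0 ≤ y i (q + β u) + |y i q| := fun i => add_nonneg (hu i) (abs_nonneg _)
  rw [pi_norm_le_iff_of_nonneg (Finset.sum_nonneg fun i _ => hnn i)]
  intro i
  refine le_trans ?_ (Finset.single_le_sum (fun i _ => hnn i) (Finset.mem_univ i))
  have h2 := hu i
  simp only [Φ, LinearMap.pi_apply, LinearMap.comp_apply, Real.norm_eq_abs]
  have e : y i (β u) = y i (q + β u) - y i q := by simp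
  rw [e]
  refine (abs_sub _ _).trans ?_
  rw [abs_of_nonneg h2]

/-- The compactification of a polyhedral cell is a ball. -/
theorem exists_map_chart [FiniteDimensional ℝ V] (hy : ∀ z, (∀ i, y i z = 0) → z = 0)
    (hβ : Function.Injective β) {j₀ : J} (hrange : LinearMap.range β = flat y S ⊓ LinearMap.ker (y j₀))
    (hq : ∀ i ∈ S, 0 < y i q) (hqS : q ∈ flat y S) :
    ∃ m : (Fin k → ℝ) → OnePoint (Fin k → ℝ),
      ContinuousOn m (Metric.closedBall 0 1) ∧ Set.InjOn m (Metric.closedBall 0 1) ∧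
      m '' Metric.ball 0 1 = (↑) '' interior (chart y q β) ∧
      m '' Metric.sphere 0 1 = {w | w = OnePoint.infty ∧ HasRecession y j₀ S} ∪
        (↑) '' (chart y q β \ interior (chart y q β)) := by
  have hβN : ∀ u, β u ∈ flat y S ⊓ LinearMap.ker (y j₀) := fun u => hrange ▸ ⟨u, rfl⟩
  have hint := interior_chart hq hqS fun u => (hβN u).1
  have hne : (interior (chart y q β)).Nonempty := ⟨0, by rw [hint]; simpa using hq⟩
  obtain ⟨K, hK0, hK⟩ := exists_norm_le_chart (q := q) hy hβ
  by_cases hrec : HasRecession y j₀ S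
  · obtain ⟨z, hz0, hz, hz', hzj⟩ := id hrec
    have hzN : z ∈ LinearMap.range β := hrange ▸ ⟨mem_flat.2 hz', hzj⟩
    obtain ⟨c₀, rfl⟩ := hzN
    have hpos := sum_pos_of_ne_zero hy hz hz0 (w := fun _ => 1) fun _ => one_pos
    simp only [one_mul] at hpos
    let h : (Fin k → ℝ) →L[ℝ] ℝ := LinearMap.toContinuousLinearMap (∑ i, y i ∘ₗ β)
    have hh : ∀ u, h u = ∑ i, y i (β u) := fun u => by simp [h]
    have hsum : ∀ u, ∑ i, y i (q + β u) = ∑ i, y i q + h u := fun u => by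
      simp [hh, Finset.sum_add_distrib]
    have habs : ∑ i, |y i q| = ∑ i, y i q := Finset.sum_congr rfl fun i _ => abs_of_nonneg (by
      by_cases hi : i ∈ S
      exacts [(hq i hi).le, (mem_flat.1 hqS i hi).ge])
    have hs0 : 0 ≤ ∑ i, y i q := habs ▸ Finset.sum_nonneg fun i _ => abs_nonneg _
    -- Here `h u` plus the constant is `∑ i, y i (q + β u) + 1`, which is at least `1` on the chart
    -- and dominates the norm. The direction is the recession vector, scaled so that `h` takes the
    -- value `1`.
    have hD : ConvexCell.Data (chart y q β) h (∑ i, y i q + 1) ((∑ i, y i (β c₀))⁻¹ • c₀) := by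
      refine ⟨isClosed_chart, convex_chart, hne, ?_, fun u hu t ht i => ?_, fun u hu => ?_,
        K * (1 + ∑ i, y i q), fun u hu => ?_⟩
      · rw [map_smul, smul_eq_mul, hh, inv_mul_cancel₀ hpos.ne']
      · have h1 := hu i
        have h2 := mul_nonneg ht (mul_nonneg (inv_nonneg.2 hpos.le) (hz i))
        simp only [map_add, map_smul, smul_eq_mul] at h1 h2 ⊢
        linarith
      · have h1 := Finset.sum_nonneg fun i (_ : i ∈ Finset.univ) => hu i
        rw [hsum] at h1
        linarith
      · have h1 := Finset.sum_nonneg fun i (_ : i ∈ Finset.univ) => hu i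
        have h2 := hK u hu
        rw [habs, hsum] at h2
        rw [hsum] at h1
        rw [mul_assoc]
        refine h2.trans (mul_le_mul_of_nonneg_left ?_ hK0)
        nlinarith
    obtain ⟨m, h1, h2, h3, h4⟩ := hD.exists_map
    refine ⟨m, h1, h2, h3, h4.trans ?_⟩
    rw [show {w : OnePoint (Fin k → ℝ) | w = OnePoint.infty ∧ HasRecession y j₀ S} =
      {OnePoint.infty} by ext; simp [hrec], Set.singleton_union]
  · obtain ⟨B, hB⟩ := exists_sum_le_of_not_hasRecession hrec
    have hb : Bornology.IsBounded (chart y q β) := by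
      refine isBounded_iff_forall_norm_le.2 ⟨K * (B * y j₀ q + ∑ i, |y i q|), fun u hu => ?_⟩
      refine (hK u hu).trans (mul_le_mul_of_nonneg_left ?_ hK0)
      have h1 := hB (q + β u) hu (mem_flat.1 (add_mem hqS (hβN u).1))
      have h2 : y j₀ (β u) = 0 := (hβN u).2
      rw [map_add (y j₀), h2, add_zero] at h1
      linarith
    obtain ⟨m, h1, h2, h3, h4⟩ := ConvexCell.exists_map_of_isBounded convex_chart isClosed_chart
      hne hb
    exact ⟨m, h1, h2, h3, h4.trans (by simp [hrec])⟩

end Chart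

end AffineMin

end

/-! ### The compactified cells as balls, and shellability for minima of affine functions. -/

section

open Module Filter Topology ConeShelling

namespace AffineMin

universe u

variable {T : Type u} [AddCommGroup T] [Module ℝ T] {I : Type u} {g : I → T →ₗ[ℝ] ℝ} {b : I → ℝ}

/-- The cell of the one-point compactification containing a point. -/
noncomputable def cellOf {η : T × ℝ × ℝ →ₗ[ℝ] ℝ}
    (hη : ∀ z, (∀ i, 0 ≤ slack g b i z) → 0 < slack g b none z →
      IsFace (slack g b) η {i | slack g b i z ≠ 0})
    (hlift : ∀ x i, 0 ≤ slack g b i (lift g b x)) : OnePoint T → CCell (slack g b) η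
  | OnePoint.infty => .inf
  | OnePoint.some x => .face (support g b x) (hη _ (hlift x) (by simp [lift]))

variable [Fintype I] [Nonempty I]

/-- A point of positive height can be rescaled to last coordinate `1`. The functional vanishing on
it is then some `some a`, so the point lies on the graph of the minimum. -/
theorem exists_support_eq {η : T × ℝ × ℝ →ₗ[ℝ] ℝ}
    (hpos : ∀ z, (∀ i, 0 ≤ slack g b i z) → 0 < η z → 0 < slack g b none z) {S : Set (Option I)}
    (hS : IsFace (slack g b) η S) (hne : S ≠ Set.univ) : ∃ x, support g b x = S := by
  obtain ⟨z, hz, hz', hηz⟩ := hS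
  have h0 : ∀ i, 0 ≤ slack g b i z := fun i => by
    by_cases hi : i ∈ S
    exacts [(hz i hi).le, (hz' i hi).ge]
  have he := hpos z h0 hηz
  obtain ⟨i, hi⟩ := (Set.ne_univ_iff_exists_notMem S).1 hne
  have hl : lift g b ((slack g b none z)⁻¹ • z).1 = (slack g b none z)⁻¹ • z := by
    refine lift_fst (inv_mul_cancel₀ he.ne') (fun i => ?_) ?_
    · rw [map_smul]
      exact mul_nonneg (inv_nonneg.2 he.le) (h0 i)
    · cases i with
      | none => exact absurd (hz' none hi) he.ne'
      | some a => exact ⟨a, by rw [map_smul, hz' _ hi, smul_zero]⟩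
  refine ⟨((slack g b none z)⁻¹ • z).1, ?_⟩
  ext i
  rw [support, hl, Set.mem_ofPred_eq, map_smul, smul_eq_mul]
  by_cases hi : i ∈ S
  · exact iff_of_true (mul_ne_zero (inv_ne_zero he.ne') (hz i hi).ne') hi
  · exact iff_of_false (by simp [hz' i hi]) hi

variable [FiniteDimensional ℝ T] [TopologicalSpace T] [IsTopologicalAddGroup T]
  [ContinuousSMul ℝ T] [T2Space T]

/-- The closure of a cell in the one-point compactification is a ball. -/
theorem exists_map_support (hg : ∀ v, (∀ a a', g a v = g a' v) → v = 0) (x₀ : T) {k : ℕ}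
    (hk : finrank ℝ (flat (slack g b) (support g b x₀)) = k + 1) :
    ∃ m : (Fin k → ℝ) → OnePoint T,
      ContinuousOn m (Metric.closedBall 0 1) ∧ Set.InjOn m (Metric.closedBall 0 1) ∧
      m '' Metric.ball 0 1 = (↑) '' {x | support g b x = support g b x₀} ∧
      m '' Metric.sphere 0 1 =
        {w | w = OnePoint.infty ∧ HasRecession (slack g b) none (support g b x₀)} ∪
        (↑) '' {x | support g b x ⊂ support g b x₀} := by
  set y := slack g b
  set S := support g b x₀
  set q := lift g b x₀
  have hqS : q ∈ flat y S := mem_flat.2 fun i hi => slack_lift_eq_zero hi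
  have hq : ∀ i ∈ S, 0 < y i q := fun i hi => lt_of_le_of_ne (slack_lift_nonneg x₀ i) (Ne.symm hi)
  have hqe : y none q = 1 := rfl
  have hN : finrank ℝ (flat y S ⊓ LinearMap.ker (y none) : Submodule ℝ (T × ℝ × ℝ)) = k := by
    have h1 := finrank_le_inf_ker (flat y S) (y none)
    have hlt : flat y S ⊓ LinearMap.ker (y none) < flat y S := by
      refine lt_of_le_of_ne inf_le_left fun he => ?_
      have h2 : y none q = 0 := (he.symm ▸ hqS : q ∈ flat y S ⊓ LinearMap.ker (y none)).2
      rw [hqe] at h2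
      exact one_ne_zero h2
    have := Submodule.finrank_lt_finrank_of_lt hlt
    omega
  let β₀ : (Fin k → ℝ) ≃ₗ[ℝ] (flat y S ⊓ LinearMap.ker (y none) : Submodule ℝ (T × ℝ × ℝ)) :=
    LinearEquiv.ofFinrankEq _ _ (by rw [hN]; simp)
  let β : (Fin k → ℝ) →ₗ[ℝ] T × ℝ × ℝ := (Submodule.subtype _) ∘ₗ β₀.toLinearMap
  have hβinj : Function.Injective β := Subtype.val_injective.comp β₀.injective
  have hβN : ∀ u, β u ∈ flat y S ⊓ LinearMap.ker (y none) := fun u => (β₀ u).2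
  have hrange : LinearMap.range β = flat y S ⊓ LinearMap.ker (y none) := by
    ext z
    constructor
    · rintro ⟨u, rfl⟩
      exact hβN u
    · intro hz
      exact ⟨β₀.symm ⟨z, hz⟩, by simp [β]⟩
  obtain ⟨a₀, ha₀⟩ := exists_notMem_support (g := g) (b := b) x₀
  let γ : (Fin k → ℝ) →ₗ[ℝ] T := LinearMap.fst ℝ T (ℝ × ℝ) ∘ₗ β
  -- The piece `a₀` is tight on the whole face, so the height coordinate is determined by the
  -- projection to `T`.
  have hγ : LinearMap.ker γ = ⊥ := by
    rw [LinearMap.ker_eq_bot']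
    intro u hu
    refine (map_eq_zero_iff β hβinj).1 ?_
    have h1 : (β u).1 = 0 := hu
    have h2 : (β u).2.2 = 0 := (hβN u).2
    have h3 : y (some a₀) (β u) = 0 := mem_flat.1 (hβN u).1 _ ha₀
    have h4 : (β u).2.1 = 0 := by
      rw [slack_some, h1, h2] at h3
      simpa using h3
    exact Prod.ext h1 (Prod.ext h4 h2)
  let α : (Fin k → ℝ) → T := fun u => x₀ + γ u
  have hα : IsClosedEmbedding α :=
    (Homeomorph.addLeft x₀).isClosedEmbedding.comp (LinearMap.isClosedEmbedding_of_injective hγ)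
  have hlift : ∀ u ∈ chart y q β, lift g b (α u) = q + β u := by
    intro u hu
    have h2 : (β u).2.2 = 0 := (hβN u).2
    refine lift_fst (z := q + β u) ?_ hu ⟨a₀, mem_flat.1 (add_mem hqS (hβN u).1) _ ha₀⟩
    simp [h2, q, lift]
  have himage : α '' chart y q β = {x | support g b x ⊆ S} := by
    ext x
    constructor
    · rintro ⟨u, hu, rfl⟩ i hi
      by_contra hiS
      refine hi ?_
      rw [hlift u hu]
      exact mem_flat.1 (add_mem hqS (hβN u).1) i hiS
    · intro hx
      have hz : lift g b x - q ∈ LinearMap.range β := by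
        rw [hrange]
        refine ⟨sub_mem (mem_flat.2 fun i hi => slack_lift_eq_zero fun h => hi (hx h)) hqS, ?_⟩
        simp [y, q, lift]
      obtain ⟨u, hu⟩ := hz
      refine ⟨u, fun i => ?_, ?_⟩
      · rw [hu, add_sub_cancel]
        exact slack_lift_nonneg x i
      · simp [α, γ, hu, q, lift]
  have hint := interior_chart (β := β) hq hqS fun u => (hβN u).1
  have hsub : interior (chart y q β) ⊆ chart y q β := interior_subset
  have himage' : α '' interior (chart y q β) = {x | support g b x = S} := by
    rw [hint] at hsub ⊢
    ext x
    constructor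
    · rintro ⟨u, hu, rfl⟩
      have h1 : α u ∈ α '' chart y q β := ⟨u, hsub hu, rfl⟩
      rw [himage] at h1
      refine Set.Subset.antisymm h1 fun i hi => ?_
      rw [support, hlift u (hsub hu)]
      exact (hu i hi).ne'
    · intro hx
      have h1 : x ∈ α '' chart y q β := himage ▸ (Eq.subset hx : support g b x ⊆ S)
      obtain ⟨u, hu, rfl⟩ := h1
      refine ⟨u, fun i hi => lt_of_le_of_ne (hu i) (Ne.symm ?_), rfl⟩
      have : i ∈ support g b (α u) := (show support g b (α u) = S from hx) ▸ hi
      rwa [support, hlift u hu] at this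
  obtain ⟨m, hm1, hm2, hm3, hm4⟩ := exists_map_chart (y := y) (j₀ := none)
    (slack_pointed (g := g) (b := b) hg) hβinj hrange hq hqS
  have hcont : Continuous (OnePoint.map α) := OnePoint.continuous_map hα.continuous (by
    simpa using hα.tendsto_cocompact)
  have hinj : Function.Injective (OnePoint.map α) := by
    intro v w hvw
    induction v using OnePoint.rec <;> induction w using OnePoint.rec <;>
      simp [hα.injective.eq_iff] at hvw ⊢
    exact hvw
  refine ⟨OnePoint.map α ∘ m, hcont.comp_continuousOn hm1, hinj.comp_injOn hm2, ?_, ?_⟩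
  · rw [Set.image_comp, hm3, ← himage', Set.image_image, Set.image_image]
    simp
  · rw [Set.image_comp, hm4, Set.image_union]
    congr 1
    · ext w
      constructor
      · rintro ⟨v, ⟨rfl, h⟩, rfl⟩
        exact ⟨rfl, h⟩
      · rintro ⟨rfl, h⟩
        exact ⟨_, ⟨rfl, h⟩, rfl⟩
    · have h1 : {x | support g b x ⊂ S} = α '' (chart y q β \ interior (chart y q β)) := by
        rw [Set.image_sdiff hα.injective, himage, himage']
        ext x
        simp [ssubset_iff_subset_ne]
      rw [h1, Set.image_image, Set.image_image]
      simp

/-- The compactification of the regions of linearity of the minimum of finitely many affine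
functions is a shellable regular cell complex. -/
theorem exists_shellable (hg : ∀ v, (∀ a a', g a v = g a' v) → v = 0) :
    ∃ _ : CWComplex (Set.univ : Set (OnePoint T)),
      RelCWComplex.Finite (Set.univ : Set (OnePoint T)) ∧
      CellShelling.IsRegular (Set.univ : Set (OnePoint T)) ∧
      Set.range (CellShelling.Cell.closed (C := (Set.univ : Set (OnePoint T)))) =
        insert {OnePoint.infty} (Set.range fun x₀ : T =>
          closure ((↑) '' {x | support g b x ⊆ support g b x₀} : Set (OnePoint T))) ∧
      CellShelling.IsShellable (Set.univ : Set (OnePoint T)) := by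
  classical
  have hT : LocallyCompactSpace T :=
    (ContinuousLinearEquiv.ofFinrankEq (𝕜 := ℝ) (E := T) (F := Fin (finrank ℝ T) → ℝ)
      (by simp)).toHomeomorph.isClosedEmbedding.locallyCompactSpace
  obtain ⟨η, hη, hface, hunb, hpos⟩ := exists_height (slack_pointed (b := b) hg) none
  let κ := cellOf hface slack_lift_nonneg
  have hκ : ∀ x : T, κ x = .face (support g b x) (hface _ (slack_lift_nonneg x) (by simp [lift])) :=
    fun _ => rfl
  -- The full support is the dome itself. The point `(0, M - 1, 1)` lies strictly below all pieces.
  have htop : IsFace (slack g b) η Set.univ := by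
    obtain ⟨M, hM⟩ := (Set.finite_range b).bddBelow
    have hM' : ∀ a, M ≤ b a := fun a => hM ⟨a, rfl⟩
    have hpos' : ∀ i, 0 < slack g b i (0, M - 1, 1) := by
      rintro (_ | a)
      · simp
      · have := hM' a
        simp only [slack_some, map_zero]
        linarith
    have := hface _ (fun i => (hpos' i).le) (hpos' none)
    rwa [show {i | slack g b i (0, M - 1, 1) ≠ 0} = Set.univ from
      Set.eq_univ_of_forall fun i => (hpos' i).ne'] at this
  have htopu : IsUnb (slack g b) η Set.univ := by
    refine (hunb _).2 ⟨(0, -1, 0), by simp, ?_, by simp, rfl⟩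
    rintro (_ | a) <;> simp
  -- The compactified decomposition is thus the boundary complex of the compactified dome, to which
  -- `exists_orderShelling` applies.
  have hrange : Set.range κ = Set.Iio (CCell.face Set.univ htop) := by
    apply Set.Subset.antisymm
    · rintro _ ⟨w, rfl⟩
      induction w using OnePoint.rec with
      | infty => exact CCell.inf_lt_face.2 htopu
      | coe x =>
        obtain ⟨a, ha⟩ := exists_notMem_support (g := g) (b := b) x
        exact CCell.face_lt_face.2 (Set.ssubset_univ_iff.2 fun h => ha (h ▸ Set.mem_univ _))
    · rintro (_ | ⟨S, hS⟩) h
      · exact ⟨OnePoint.infty, rfl⟩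
      · obtain ⟨x, rfl⟩ := exists_support_eq hpos hS (Set.ssubset_univ_iff.1 (CCell.face_lt_face.1 h))
        exact ⟨x, rfl⟩
  have hdec : CellShelling.Decomposition κ CCell.dim := by
    refine ⟨Set.toFinite _, ?_, ?_, ?_⟩
    · rw [hrange]
      exact fun a b hab hb => lt_of_le_of_lt hab hb
    · rintro (_ | ⟨A, hA⟩) (_ | ⟨S, hS⟩) h
      · exact absurd h (lt_irrefl _)
      · have := hS.two_le_finrank hη (CCell.inf_lt_face.1 h)
        simp only [CCell.dim]; omega
      · exact absurd h CCell.not_lt_inf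
      · have h1 := hS.finrank_lt (CCell.face_lt_face.1 h)
        have h2 := hA.finrank_pos
        simp only [CCell.dim]; omega
    · rintro _ ⟨w, rfl⟩
      induction w using OnePoint.rec with
      | infty =>
        have hpre : κ ⁻¹' {CCell.inf} = {OnePoint.infty} := by
          ext w
          induction w using OnePoint.rec with
          | infty => simp; rfl
          | coe x => simp [hκ]
        -- Making the dimension a variable allows it to be replaced by `0`.
        suffices h : ∀ k, k = 0 → ∃ m : (Fin k → ℝ) → OnePoint T,
            ContinuousOn m (Metric.closedBall 0 1) ∧ Set.InjOn m (Metric.closedBall 0 1) ∧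
            m '' Metric.ball 0 1 = κ ⁻¹' {CCell.inf} ∧
            m '' Metric.sphere 0 1 = κ ⁻¹' Set.Iio CCell.inf from h _ rfl
        rintro _ rfl
        refine ⟨fun _ => OnePoint.infty, continuousOn_const, fun a _ b _ _ => Subsingleton.elim a b,
          ?_, ?_⟩
        · rw [hpre]
          exact Set.Nonempty.image_const ⟨0, by simp⟩ _
        · rw [Metric.sphere_eq_empty_of_subsingleton one_ne_zero, Set.image_empty]
          exact (Set.eq_empty_of_forall_notMem fun w hw => CCell.not_lt_inf hw).symm
      | coe x =>
        have hS := hface _ (slack_lift_nonneg x) (by simp [lift])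
        obtain ⟨m, h1, h2, h3, h4⟩ := exists_map_support (b := b) hg x
          (k := finrank ℝ (flat (slack g b) (support g b x)) - 1) (by
            have : 0 < finrank ℝ (flat (slack g b) (support g b x)) := hS.finrank_pos
            omega)
        refine ⟨m, h1, h2, h3.trans ?_, h4.trans ?_⟩
        · ext w
          induction w using OnePoint.rec with
          | infty => simp [hκ]; rintro ⟨⟩
          | coe x' =>
            have : κ x' = κ x ↔ _ := CCell.face_inj
            simp [this]
        · ext w
          induction w using OnePoint.rec with
          | infty =>
            have : κ OnePoint.infty < κ x ↔ _ := CCell.inf_lt_face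
            simp [this, hunb]
          | coe x' =>
            have : κ x' < κ x ↔ _ := CCell.face_lt_face
            simp [this]
  have hsh : ∃ l, OrderShelling CCell.dim (Set.range κ) l := by
    rw [hrange]
    refine exists_orderShelling hη htop ?_
    have : flat (slack g b) Set.univ = ⊤ := by ext; simp [mem_flat]
    rw [this, finrank_top]
    simp
  obtain ⟨C, h1, h2, h3, h4⟩ := hdec.exists_shellable hsh
  refine ⟨C, h1, h2, h3.trans ?_, h4⟩
  rw [← Set.range_comp]
  have hcl : ∀ x₀ : T, κ ⁻¹' Set.Iic (κ x₀) =
      closure ((↑) '' {x | support g b x ⊆ support g b x₀} : Set (OnePoint T)) := by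
    intro x₀
    obtain ⟨m, hm1, -, hm3, hm4⟩ := hdec.map (κ x₀) ⟨_, rfl⟩
    have hball : m '' Metric.closedBall 0 1 = κ ⁻¹' Set.Iic (κ x₀) := by
      rw [← Metric.ball_union_sphere, Set.image_union, hm3, hm4, ← Set.preimage_union,
        Set.singleton_union, Set.Iio_insert]
    have hsub : ((↑) '' {x | support g b x ⊆ support g b x₀} : Set (OnePoint T)) ⊆
        κ ⁻¹' Set.Iic (κ x₀) := by
      rintro _ ⟨x, hx, rfl⟩
      have h : κ x ≤ κ x₀ := hx
      exact h
    have hsub' : m '' Metric.ball 0 1 ⊆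
        ((↑) '' {x | support g b x ⊆ support g b x₀} : Set (OnePoint T)) := by
      rw [hm3]
      intro w hw
      induction w using OnePoint.rec with
      | infty => cases hw
      | coe x =>
        have h : κ x ≤ κ x₀ := le_of_eq hw
        exact ⟨x, h, rfl⟩
    apply Set.Subset.antisymm
    -- The closed cell is the image of the closure of the open ball, so it lies in the closure of
    -- the open cell.
    · rw [← hball, ← closure_ball 0 one_ne_zero]
      refine (ContinuousOn.image_closure ?_).trans (closure_mono hsub')
      rwa [closure_ball 0 one_ne_zero]
    · refine closure_minimal hsub ?_
      rw [← hball]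
      exact ((isCompact_closedBall 0 1).image_of_continuousOn hm1).isClosed
  ext s
  simp only [Set.mem_range, Set.mem_insert_iff, Function.comp_apply]
  have hinf : κ ⁻¹' Set.Iic (κ OnePoint.infty) = {OnePoint.infty} := by
    ext w
    induction w using OnePoint.rec with
    | infty => simp
    | coe x =>
      simp only [Set.mem_preimage, Set.mem_Iic, Set.mem_singleton_iff, OnePoint.coe_ne_infty,
        iff_false]
      exact CCell.not_face_le_inf
  rw [OnePoint.exists]
  rw [hinf]
  simp only [hcl]
  exact or_congr eq_comm Iff.rfl

end AffineMin

end

/-! ### Covector decompositions as faces of the dome of a minimum of affine functions. -/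

section

open Module Filter Topology AffineMin

namespace TropicalCovector

variable {d n : ℕ}

/-- The slack of the linear piece of `L_V` indexed by `a` at a point of the dome. -/
def pieceSlack (V : Matrix (Fin d) (Fin n) ℝ) (a : Fin n → Fin d) (p : (Fin d → ℝ) × ℝ) : ℝ :=
  ∑ j, (p.1 (a j) - V (a j) j) - p.2

/-- The linear pieces of `L_V`, normalized to functions on the torus. -/
def piece (i₀ : Fin d) (a : Fin n → Fin d) : Torus d →ₗ[ℝ] ℝ :=
  Submodule.liftQ _ (∑ j, ((LinearMap.proj (a j) : (Fin d → ℝ) →ₗ[ℝ] ℝ) - LinearMap.proj i₀)) (by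
    rw [Submodule.span_singleton_le_iff_mem, LinearMap.mem_ker, LinearMap.sum_apply]
    exact Finset.sum_eq_zero fun j _ => by simp)

/-- The constant terms of the linear pieces. -/
def pieceConst (V : Matrix (Fin d) (Fin n) ℝ) (a : Fin n → Fin d) : ℝ := - ∑ j, V (a j) j

variable {V : Matrix (Fin d) (Fin n) ℝ}

theorem piece_mk (i₀ : Fin d) (a : Fin n → Fin d) (x : Fin d → ℝ) :
    piece i₀ a (Submodule.Quotient.mk x) = ∑ j, (x (a j) - x i₀) := by
  rw [piece, Submodule.liftQ_apply, LinearMap.sum_apply]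
  rfl

theorem linearProduct_le (x : Fin d → ℝ) (a : Fin n → Fin d) :
    linearProduct V x ≤ ∑ j, (x (a j) - V (a j) j) :=
  Finset.sum_le_sum fun j _ => ciInf_le (f := fun i => x i - V i j) (Set.finite_range _).bddBelow _

theorem exists_linearProduct_eq [Nonempty (Fin d)] (x : Fin d → ℝ) :
    ∃ a : Fin n → Fin d, linearProduct V x = ∑ j, (x (a j) - V (a j) j) := by
  have h : ∀ j, ∃ i, x i - V i j = ⨅ i, (x i - V i j) := fun j => exists_eq_ciInf_of_finite
  choose a ha using h
  exact ⟨a, Finset.sum_congr rfl fun j _ => (ha j).symm⟩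

theorem mem_dome_iff [Nonempty (Fin d)] (p : (Fin d → ℝ) × ℝ) :
    p ∈ dome V ↔ ∀ a, 0 ≤ pieceSlack V a p := by
  constructor
  · intro (hp : p.2 ≤ _) a
    have := linearProduct_le (V := V) p.1 a
    unfold pieceSlack
    linarith
  · intro h
    obtain ⟨a, ha⟩ := exists_linearProduct_eq (V := V) p.1
    have := h a
    unfold pieceSlack at this
    change p.2 ≤ _
    linarith

theorem eq_linearProduct {p : (Fin d → ℝ) × ℝ} (hp : p ∈ dome V) {a : Fin n → Fin d}
    (ha : pieceSlack V a p = 0) : p.2 = linearProduct V p.1 := by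
  refine le_antisymm hp ?_
  have := linearProduct_le (V := V) p.1 a
  unfold pieceSlack at ha
  linarith

/-- `L_V` grows by `n * t` under translation by `t • 1`. Subtracting `n * x i₀` makes it descend to
the torus without changing any slack. -/
theorem minVal_piece [Nonempty (Fin d)] (i₀ : Fin d) (x : Fin d → ℝ) :
    minVal (piece i₀) (pieceConst V) (Submodule.Quotient.mk x) =
      linearProduct V x - n * x i₀ := by
  have h : ∀ a, piece i₀ a (Submodule.Quotient.mk x) + pieceConst V a =
      ∑ j, (x (a j) - V (a j) j) - n * x i₀ := fun a => by
    rw [piece_mk, pieceConst]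
    simp only [Finset.sum_sub_distrib, Finset.sum_const, Finset.card_univ, Fintype.card_fin,
      nsmul_eq_mul]
    ring
  have : Nonempty (Fin n → Fin d) := ⟨fun _ => i₀⟩
  apply le_antisymm
  · obtain ⟨a, ha⟩ := exists_linearProduct_eq (V := V) x
    have := minVal_le (g := piece i₀) (b := pieceConst V) (Submodule.Quotient.mk x) a
    rw [h] at this
    linarith
  · refine le_ciInf fun a => ?_
    rw [h]
    have := linearProduct_le (V := V) x a
    linarith

theorem some_mem_support [Nonempty (Fin d)] (i₀ : Fin d) (x : Fin d → ℝ) (a : Fin n → Fin d) :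
    some a ∈ support (piece i₀) (pieceConst V) (Submodule.Quotient.mk x) ↔
      pieceSlack V a (x, linearProduct V x) ≠ 0 := by
  have : slack (piece i₀) (pieceConst V) (some a)
      (lift (piece i₀) (pieceConst V) (Submodule.Quotient.mk x)) =
      pieceSlack V a (x, linearProduct V x) := by
    simp only [slack_some, lift, minVal_piece, piece_mk, pieceConst, pieceSlack]
    simp only [Finset.sum_sub_distrib, Finset.sum_const, Finset.card_univ, Fintype.card_fin,
      nsmul_eq_mul]
    ring
  rw [AffineMin.support, Set.mem_ofPred_eq, this]

/-- A tight piece forces the points of the face onto the graph of `L_V`, so their slacks depend only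
on the projection. -/
theorem image_mk_face [Nonempty (Fin d)] (i₀ : Fin d) {p : (Fin d → ℝ) × ℝ} (hp : p ∈ dome V)
    (ha : ∃ a, pieceSlack V a p = 0) :
    (fun p => (Submodule.Quotient.mk p.1 : Torus d)) ''
        {q ∈ dome V | ∀ a, pieceSlack V a p = 0 → pieceSlack V a q = 0} =
      {x | support (piece i₀) (pieceConst V) x ⊆
        support (piece i₀) (pieceConst V) (Submodule.Quotient.mk p.1)} := by
  obtain ⟨a₀, ha₀⟩ := ha
  have hpe : (p.1, linearProduct V p.1) = p := Prod.ext rfl (eq_linearProduct hp ha₀).symm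
  have hsub : ∀ x : Fin d → ℝ, support (piece i₀) (pieceConst V) (Submodule.Quotient.mk x) ⊆
      support (piece i₀) (pieceConst V) (Submodule.Quotient.mk p.1) ↔
      ∀ a, pieceSlack V a p = 0 → pieceSlack V a (x, linearProduct V x) = 0 := by
    intro x
    constructor
    · intro h a ha
      by_contra hne
      have := h ((some_mem_support i₀ x a).2 hne)
      rw [some_mem_support, hpe] at this
      exact this ha
    · rintro h (_ | a) hi
      · exact none_mem_support _
      · rw [some_mem_support] at hi ⊢
        rw [hpe]
        exact fun h0 => hi (h a h0)
  ext x
  obtain ⟨x, rfl⟩ := Submodule.Quotient.mk_surjective _ x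
  rw [Set.mem_ofPred_eq, hsub]
  constructor
  · rintro ⟨q, ⟨hq, hqa⟩, hqx⟩
    rw [← hsub]
    have hqe : (q.1, linearProduct V q.1) = q :=
      Prod.ext rfl (eq_linearProduct hq (hqa a₀ ha₀)).symm
    simp only at hqx
    rw [← hqx, hsub, hqe]
    exact hqa
  · intro h
    exact ⟨(x, linearProduct V x), ⟨le_refl (linearProduct V x), h⟩, rfl⟩

/-- The slacks are affine functions. -/
theorem pieceSlack_add_smul (a : Fin n → Fin d) (p q : (Fin d → ℝ) × ℝ) (t : ℝ) :
    pieceSlack V a (p + t • (p - q)) =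
      pieceSlack V a p + t * (pieceSlack V a p - pieceSlack V a q) := by
  simp only [pieceSlack, Prod.fst_add, Prod.smul_fst, Prod.fst_sub, Prod.snd_add, Prod.smul_snd,
    Prod.snd_sub, Pi.add_apply, Pi.smul_apply, Pi.sub_apply, smul_eq_mul, Finset.sum_sub_distrib,
    Finset.sum_add_distrib, ← Finset.mul_sum]
  ring

/-- Up to a constant, the exposing functional is minus the sum of the slacks tight at `p`. It is
maximal on the dome exactly where all of these vanish. -/
theorem isExposed_face [Nonempty (Fin d)] {p : (Fin d → ℝ) × ℝ} (hp : p ∈ dome V) :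
    IsExposed ℝ (dome V) {q ∈ dome V | ∀ a, pieceSlack V a p = 0 → pieceSlack V a q = 0} := by
  classical
  rintro -
  let A : Finset (Fin n → Fin d) := Finset.univ.filter fun a => pieceSlack V a p = 0
  let l : ((Fin d → ℝ) × ℝ) →ₗ[ℝ] ℝ := ∑ a ∈ A, (LinearMap.snd ℝ (Fin d → ℝ) ℝ -
    ∑ j, LinearMap.proj (a j) ∘ₗ LinearMap.fst ℝ (Fin d → ℝ) ℝ)
  have hl : ∀ q, l q = - ∑ a ∈ A, ∑ j, V (a j) j - ∑ a ∈ A, pieceSlack V a q := by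
    intro q
    simp only [l, pieceSlack, LinearMap.sum_apply, LinearMap.sub_apply, LinearMap.comp_apply,
      LinearMap.proj_apply, LinearMap.fst_apply, LinearMap.snd_apply, Finset.sum_sub_distrib]
    ring
  have hpA : ∑ a ∈ A, pieceSlack V a p = 0 := Finset.sum_eq_zero fun a ha =>
    (Finset.mem_filter.1 ha).2
  have hnn : ∀ q ∈ dome V, ∀ a ∈ A, 0 ≤ pieceSlack V a q := fun q hq a _ => (mem_dome_iff q).1 hq a
  refine ⟨LinearMap.toContinuousLinearMap l, Set.ext fun q => and_congr_right fun hq => ?_⟩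
  simp only [LinearMap.coe_toContinuousLinearMap']
  constructor
  · intro h r hr
    have h1 : ∑ a ∈ A, pieceSlack V a q = 0 := Finset.sum_eq_zero fun a ha =>
      h a (Finset.mem_filter.1 ha).2
    have h2 := Finset.sum_nonneg (hnn r hr)
    rw [hl, hl]
    linarith
  · intro h a ha
    have h1 := h p hp
    rw [hl, hl, hpA] at h1
    have h2 := Finset.sum_nonneg (hnn q hq)
    have h3 := (Finset.sum_eq_zero_iff_of_nonneg (hnn q hq)).1 (by linarith)
    exact h3 a (Finset.mem_filter.2 ⟨Finset.mem_univ a, ha⟩)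

theorem exists_eq_face_of_isExposed [Nonempty (Fin d)] {F : Set ((Fin d → ℝ) × ℝ)}
    (hF : IsExposed ℝ (dome V) F) (hne : F.Nonempty) :
    ∃ p ∈ dome V, F = {q ∈ dome V | ∀ a, pieceSlack V a p = 0 → pieceSlack V a q = 0} := by
  obtain ⟨l, hl⟩ := hF hne
  -- A point with the largest set of strict inequalities is relatively interior to `F`. If some `q ∈
  -- F` were strict at an inequality tight at `p`, the midpoint of `p` and `q` would be strict at
  -- more.
  obtain ⟨_, ⟨p, hpF, rfl⟩, hmax⟩ := (Set.toFinite
    ((fun p => {a | pieceSlack V a p ≠ 0}) '' F)).exists_maximal (hne.image _)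
  have hpD : p ∈ dome V := by rw [hl] at hpF; exact hpF.1
  refine ⟨p, hpD, Set.Subset.antisymm (fun q hq => ?_) fun q hq => ?_⟩
  · have hqD : q ∈ dome V := by rw [hl] at hq; exact hq.1
    refine ⟨hqD, fun a ha => ?_⟩
    have hslack : ∀ a, pieceSlack V a (p + (-(1 / 2) : ℝ) • (p - q)) =
        (pieceSlack V a p + pieceSlack V a q) / 2 := fun a => by
      rw [pieceSlack_add_smul]; ring
    have hmF : p + (-(1 / 2) : ℝ) • (p - q) ∈ F := by
      have hp1 := hpF
      have hq1 := hq
      rw [hl] at hp1 hq1 ⊢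
      refine ⟨(mem_dome_iff _).2 fun a => ?_, fun r hr => ?_⟩
      · rw [hslack]
        have := (mem_dome_iff p).1 hpD a
        have := (mem_dome_iff q).1 hqD a
        linarith
      · have h1 := hp1.2 r hr
        have h2 := hq1.2 r hr
        simp only [map_add, map_smul, map_sub, smul_eq_mul]
        linarith
    by_contra hne'
    have h1 : a ∈ {a | pieceSlack V a (p + (-(1 / 2) : ℝ) • (p - q)) ≠ 0} := by
      rw [Set.mem_ofPred_eq, hslack, ha, zero_add]
      exact div_ne_zero hne' two_ne_zero
    have h2 : {a | pieceSlack V a p ≠ 0} ≤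
        {a | pieceSlack V a (p + (-(1 / 2) : ℝ) • (p - q)) ≠ 0} := by
      intro c hc
      rw [Set.mem_ofPred_eq] at hc ⊢
      rw [hslack]
      have h3 := lt_of_le_of_ne ((mem_dome_iff p).1 hpD c) (Ne.symm hc)
      have h4 := (mem_dome_iff q).1 hqD c
      positivity
    exact hmax ⟨_, hmF, rfl⟩ h2 h1 ha
  · obtain ⟨hqD, hq⟩ := hq
    -- The segment from `q` to `p` can be prolonged a little beyond `p` inside the dome, because
    -- what is tight at `p` is tight at `q`. As `l` is maximal at `p`, it cannot be smaller at `q`.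
    have hev : ∀ a, ∀ᶠ t : ℝ in 𝓝[>] 0, 0 ≤ pieceSlack V a (p + t • (p - q)) := by
      intro a
      simp only [pieceSlack_add_smul]
      rcases ((mem_dome_iff p).1 hpD a).eq_or_lt with h0 | h0
      · rw [← h0, hq a h0.symm]
        simp
      · have hc : ContinuousAt (fun t : ℝ => pieceSlack V a p +
            t * (pieceSlack V a p - pieceSlack V a q)) 0 := by fun_prop
        have h1 := hc.eventually (lt_mem_nhds (a := 0) (by simpa using h0))
        exact nhdsWithin_le_nhds (h1.mono fun t ht => ht.le)
    have h3 : ∀ᶠ t : ℝ in 𝓝[>] 0, 0 < t := self_mem_nhdsWithin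
    obtain ⟨t, ht, ht0⟩ := ((eventually_all.2 hev).and h3).exists
    rw [hl] at hpF ⊢
    have h4 := hpF.2 _ ((mem_dome_iff _).2 ht)
    simp only [map_add, map_smul, map_sub, smul_eq_mul] at h4
    have h5 : l p ≤ l q := by
      by_contra! h
      have := mul_pos ht0 (sub_pos.2 h)
      linarith
    exact ⟨hqD, fun r hr => (hpF.2 r hr).trans h5⟩

/-- The cells of the covector decomposition in terms of supports. -/
theorem decomposition_eq [Nonempty (Fin d)] (i₀ : Fin d) (V : Matrix (Fin d) (Fin n) ℝ) :
    decomposition V = Set.range fun x₀ : Torus d => {x | support (piece i₀) (pieceConst V) x ⊆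
      support (piece i₀) (pieceConst V) x₀} := by
  ext P
  constructor
  · rintro ⟨F, hF, hne, hproper, rfl⟩
    obtain ⟨p, hp, rfl⟩ := exists_eq_face_of_isExposed hF hne
    have ha : ∃ a, pieceSlack V a p = 0 := by
      by_contra! h
      exact hproper (Set.ext fun q => and_iff_left fun a ha => absurd ha (h a))
    exact ⟨Submodule.Quotient.mk p.1, (image_mk_face i₀ hp ha).symm⟩
  · rintro ⟨x₀, rfl⟩
    obtain ⟨x, rfl⟩ := Submodule.Quotient.mk_surjective _ x₀
    have hp : (x, linearProduct V x) ∈ dome V := le_refl (linearProduct V x)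
    have ha : ∃ a, pieceSlack V a (x, linearProduct V x) = 0 := by
      obtain ⟨a, ha⟩ := exists_linearProduct_eq (V := V) x
      exact ⟨a, by simp only [pieceSlack, ha, sub_self]⟩
    refine ⟨_, isExposed_face hp, ⟨_, hp, fun _ h => h⟩, fun h => ?_, (image_mk_face i₀ hp ha).symm⟩
    obtain ⟨a, ha⟩ := ha
    -- A point strictly below the graph shows that the face is proper.
    have h1 : (x, linearProduct V x - 1) ∈ dome V := by
      change linearProduct V x - 1 ≤ linearProduct V x
      linarith
    rw [← h] at h1
    have h2 := h1.2 a ha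
    simp only [pieceSlack] at ha h2
    linarith

/-- The constant choices `i` and `i₀` differ by `n * (x i - x i₀)`, and `n` is nonzero. -/
theorem piece_separates (hn : 1 ≤ n) (i₀ : Fin d) (v : Torus d)
    (hv : ∀ a a' : Fin n → Fin d, piece i₀ a v = piece i₀ a' v) : v = 0 := by
  obtain ⟨x, rfl⟩ := Submodule.Quotient.mk_surjective _ v
  rw [Submodule.Quotient.mk_eq_zero, Submodule.mem_span_singleton]
  refine ⟨x i₀, funext fun i => ?_⟩
  have h := hv (fun _ => i) (fun _ => i₀)
  simp only [piece_mk, sub_self, Finset.sum_const_zero, Finset.sum_const, Finset.card_univ,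
    Fintype.card_fin, nsmul_eq_mul, mul_eq_zero, Nat.cast_eq_zero] at h
  rcases h with h | h
  · omega
  · simp; linarith

theorem t2Space_torus : T2Space (Torus d) := by
  have : IsClosed (Submodule.span ℝ {(1 : Fin d → ℝ)} : Set (Fin d → ℝ)) :=
    Submodule.closed_of_finiteDimensional _
  have := Submodule.t3_quotient_of_isClosed (Submodule.span ℝ {(1 : Fin d → ℝ)})
  infer_instance

theorem finrank_torus (hd : 1 ≤ d) : finrank ℝ (Torus d) + 1 = d := by
  have h := Submodule.finrank_quotient_add_finrank (Submodule.span ℝ {(1 : Fin d → ℝ)})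
  have : Nonempty (Fin d) := ⟨⟨0, hd⟩⟩
  rw [finrank_span_singleton one_ne_zero] at h
  simpa using h

end TropicalCovector

end

theorem mainTheorem10 (d n : ℕ) (hd : 1 ≤ d) (hn : 1 ≤ n) (V : Matrix (Fin d) (Fin n) ℝ) :
    Nonempty (OnePoint (TropicalCovector.Torus d) ≃ₜ
      Metric.sphere (0 : EuclideanSpace ℝ (Fin d)) 1) ∧
    ∃ _ : Topology.CWComplex (Set.univ : Set (OnePoint (TropicalCovector.Torus d))),
      Topology.RelCWComplex.Finite (Set.univ : Set (OnePoint (TropicalCovector.Torus d))) ∧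
      CellShelling.IsRegular (Set.univ : Set (OnePoint (TropicalCovector.Torus d))) ∧
      Set.range (CellShelling.Cell.closed
        (C := (Set.univ : Set (OnePoint (TropicalCovector.Torus d))))) =
        TropicalCovector.compactifiedCells V ∧
      CellShelling.IsShellable (Set.univ : Set (OnePoint (TropicalCovector.Torus d))) := by
  have := TropicalCovector.t2Space_torus (d := d)
  refine ⟨⟨onePointEquivSphereOfFinrankEq (by simpa using TropicalCovector.finrank_torus hd)⟩, ?_⟩
  have i₀ : Fin d := ⟨0, hd⟩
  have : Nonempty (Fin d) := ⟨i₀⟩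
  obtain ⟨C, h1, h2, h3, h4⟩ := AffineMin.exists_shellable (b := TropicalCovector.pieceConst V)
    (TropicalCovector.piece_separates hn i₀)
  refine ⟨C, h1, h2, h3.trans ?_, h4⟩
  rw [TropicalCovector.compactifiedCells, TropicalCovector.decomposition_eq i₀, ← Set.range_comp]
  rfl
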